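/- Let $X$ be a path-connected topological space. A singular $k$-simplex is a continuous map $\Delta^k\to X$; the set $S_k(X)$ of all of them carries the compact-open topology and its Borel $\sigma$-algebra. For $x_0\in X$ let $S_k^{x_0}(X)\subset S_k(X)$ be the subspace of simplices all of whose vertices are mapped to $x_0$. A set $D$ (not necessarily measurable) is a determination set of a signed measure $\mu$ if $\mu$ vanishes on every measurable subset of the complement of $D$. Let $\mathcal C_k(X)$ be the real vector space of signed measures of finite variation on $S_k(X)$ that have a compact determination set (compact sets need not be Hausdorff), with boundary operator $\partial=\sum_i(-1)^i(\partial_i)_*$ induced by the face maps $\partial_i$, and let $\mathcal C_k^{x_0}(X)\subset\mathcal C_k(X)$ be the subcomplex of those $\mu$ for which $S_k^{x_0}(X)$ is a determination set; $\iota\colon\mathcal C_*^{x_0}(X)\to\mathcal C_*(X)$ is the inclusion. Assume that $X=\bigcup_{i=1}^nU_i$ for finitely many Borel sets $U_1,\dots,U_n$ whose closures $\overline U_i$ are compact and contractible in $X$ (that is, the inclusion $\overline U_i\to X$ is homotopic to a constant map). Then for every $x_0\in X$: 1. There are a chain map $\eta_*\colon\mathcal C_*(X)\to\mathcal C_*^{x_0}(X)$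 with $\eta\iota=\mathrm{id}$ and a chain homotopy $s_*\colon\mathcal C_*(X)\to\mathcal C_{*+1}(X)$ (a family of linear maps) with $\partial s+s\partial=\iota\eta-\mathrm{id}$. In particular $\iota$ is a chain homotopy equivalence. 2. For every $k\ge 0$, every cycle in $\mathcal C_k(X)$ is homologous in $\mathcal C_*(X)$ to a cycle that has a compact determination set contained in $S_k^{x_0}(X)$. 3. In every degree $k\ge 0$, restriction of cochains from $S_*(X)$ to $S_*^{x_0}(X)$ induces isomorphisms $$H_b^k(X)\to H_{b,x_0}^k(X),\qquad \mathcal H_b^k(X)\to\mathcal H_{b,x_0}^k(X),\qquad \mathcal H^k(X)\to\mathcal H_{x_0}^k(X),$$ where $H_b^*$, $\mathcal H_b^*$ and $\mathcal H^*$ denote the cohomology of the complexes of bounded, of bounded Borel-measurable and of Borel-measurable functions $S_k(X)\to\mathbb R$ respectively, with coboundary $(\delta f)(\sigma)=\sum_i(-1)^if(\partial_i\sigma)$, and the groups with index $x_0$ are defined in the same way by functions on $S_k^{x_0}(X)$. -/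

import Mathlib

open CategoryTheory MeasureTheory

noncomputable section

namespace MeasureHomology

universe u

/-! ### Alternating sums of faces -/

/-- The combinatorial identity behind `∂ ∘ ∂ = 0`. -/
theorem alternating_double_sum {M : Type*} [AddCommGroup M] [Module ℝ M] {n : ℕ}
    (F : Fin (n + 2) → Fin (n + 3) → M)
    (hF : ∀ i j : Fin (n + 2), i ≤ j → F i j.succ = F j i.castSucc) :
    ∑ i : Fin (n + 2), ∑ j : Fin (n + 3), ((-1 : ℝ) ^ (i : ℕ) * (-1 : ℝ) ^ (j : ℕ)) • F i j
      = 0 := by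
  simp only [← Finset.sum_product']
  let P := Fin (n + 2) × Fin (n + 3)
  let S : Finset P := {ij : P | (ij.2 : ℕ) ≤ (ij.1 : ℕ)}
  rw [Finset.univ_product_univ, ← Finset.sum_add_sum_compl S, ← eq_neg_iff_add_eq_zero,
    ← Finset.sum_neg_distrib]
  let φ : ∀ ij : P, ij ∈ S → P := fun ij hij =>
    (Fin.castLT ij.2 (lt_of_le_of_lt (Finset.mem_filter.mp hij).right (Fin.is_lt ij.1)),
      ij.1.succ)
  apply Finset.sum_bij φ
  · intro ij hij
    simp_rw [S, φ, Finset.compl_filter, Finset.mem_filter_univ, Fin.val_succ,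
      Fin.val_castLT] at hij ⊢
    lia
  · rintro ⟨i, j⟩ hij ⟨i', j'⟩ hij' h
    rw [Prod.mk_inj]
    exact ⟨by simpa [φ] using! congr_arg Prod.snd h,
      by simpa [φ, Fin.castSucc_castLT] using! congr_arg Fin.castSucc (congr_arg Prod.fst h)⟩
  · rintro ⟨i', j'⟩ hij'
    simp_rw [S, Finset.compl_filter, Finset.mem_filter_univ, not_le] at hij'
    refine ⟨(j'.pred <| ?_, Fin.castSucc i'), ?_, ?_⟩
    · rintro rfl
      simp only [Fin.val_zero, not_lt_zero] at hij'
    · simpa [S] using! Nat.le_sub_one_of_lt hij'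
    · simp only [φ, Fin.castLT_castSucc, Fin.succ_pred]
  · rintro ⟨i, j⟩ hij
    have hle : (j : ℕ) ≤ (i : ℕ) := by simpa [S] using! hij
    have hlt : (j : ℕ) < n + 2 := lt_of_le_of_lt hle i.isLt
    have h := hF (j.castLT hlt) i hle
    rw [Fin.castSucc_castLT] at h
    dsimp only [φ]
    rw [h, ← neg_smul]
    congr 1
    simp only [Fin.val_succ, Fin.val_castLT, pow_succ]
    ring

/-! ### Singular simplices -/

/-- The standard `k`-simplex `Δ^k`. -/
abbrev StdSimplex (k : ℕ) : Type := stdSimplex ℝ (Fin (k + 1))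

/-- `map(Δ^k, X)`: the singular `k`-simplices of `X`. -/
def SingularSimplex (k : ℕ) (X : Type u) [TopologicalSpace X] : Type u := C(StdSimplex k, X)

/-- The compact-open topology on `map(Δ^k, X)`. -/
instance (k : ℕ) (X : Type u) [TopologicalSpace X] : TopologicalSpace (SingularSimplex k X) :=
  inferInstanceAs (TopologicalSpace C(StdSimplex k, X))

/-- The Borel σ-algebra of the compact-open topology on `map(Δ^k, X)`. -/
instance (k : ℕ) (X : Type u) [TopologicalSpace X] : MeasurableSpace (SingularSimplex k X) :=
  borel _

instance (k : ℕ) (X : Type u) [TopologicalSpace X] : BorelSpace (SingularSimplex k X) := ⟨rfl⟩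

/-- The inclusion `Δ^k → Δ^(k+1)` of the face opposite to the vertex `v_i`. -/
def faceInclusion (k : ℕ) (i : Fin (k + 2)) : C(StdSimplex k, StdSimplex (k + 1)) :=
  ⟨stdSimplex.map i.succAbove, stdSimplex.continuous_map _⟩

/-- The vertex `v_i` of `Δ^k`. -/
def vertex (k : ℕ) (i : Fin (k + 1)) : StdSimplex k := stdSimplex.vertex i

/-- The `i`-th face `∂_i σ` of a singular simplex. -/
def face {X : Type u} [TopologicalSpace X] {k : ℕ} (i : Fin (k + 2))
    (σ : SingularSimplex (k + 1) X) : SingularSimplex k X :=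
  ContinuousMap.comp σ (faceInclusion k i)

/-- The value `σ(v_i)` of a singular simplex at the `i`-th vertex. -/
def atVertex {X : Type u} [TopologicalSpace X] {k : ℕ} (σ : SingularSimplex k X)
    (i : Fin (k + 1)) : X :=
  ContinuousMap.toFun σ (vertex k i)

theorem continuous_face {X : Type u} [TopologicalSpace X] {k : ℕ} (i : Fin (k + 2)) :
    Continuous (face (X := X) i) :=
  ContinuousMap.continuous_precomp (faceInclusion k i)

theorem measurable_face {X : Type u} [TopologicalSpace X] {k : ℕ} (i : Fin (k + 2)) :
    Measurable (face (X := X) i) :=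
  (continuous_face i).measurable

theorem face_face {X : Type u} [TopologicalSpace X] {k : ℕ} (i j : Fin (k + 2)) (h : i ≤ j)
    (σ : SingularSimplex (k + 2) X) :
    face i (face j.succ σ) = face j (face i.castSucc σ) := by
  refine ContinuousMap.ext fun x => ?_
  change σ.toFun (stdSimplex.map _ (stdSimplex.map _ x)) =
    σ.toFun (stdSimplex.map _ (stdSimplex.map _ x))
  rw [stdSimplex.map_comp_apply, stdSimplex.map_comp_apply]
  congr 2
  funext a
  simp only [Function.comp_apply]
  have := congrArg (fun f => f.toOrderHom a) (SimplexCategory.δ_comp_δ h)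
  simpa using! this

theorem atVertex_face {X : Type u} [TopologicalSpace X] {k : ℕ} (i : Fin (k + 2))
    (σ : SingularSimplex (k + 1) X) (a : Fin (k + 1)) :
    atVertex (face i σ) a = atVertex σ (i.succAbove a) := by
  change σ.toFun (stdSimplex.map _ (stdSimplex.vertex a)) = _
  rw [stdSimplex.map_vertex]
  rfl

/-- `S_k^{x₀}(X)`: the singular simplices with all vertices in `x₀`. -/
def pointedSimplices (X : Type u) [TopologicalSpace X] (x₀ : X) (k : ℕ) :
    Set (SingularSimplex k X) :=
  {σ | ∀ i, atVertex σ i = x₀}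

theorem face_mem_pointedSimplices {X : Type u} [TopologicalSpace X] {x₀ : X} {k : ℕ}
    (i : Fin (k + 2)) {σ : SingularSimplex (k + 1) X} (h : σ ∈ pointedSimplices X x₀ (k + 1)) :
    face i σ ∈ pointedSimplices X x₀ k :=
  fun a => (atVertex_face i σ a).trans (h _)

/-! ### Measure chains -/

/-- `D` (not necessarily measurable) is a determination set of `μ`: the signed measure `μ`
vanishes on each measurable subset of the complement of `D`. -/
def IsDeterminationSet {α : Type u} [MeasurableSpace α] (μ : SignedMeasure α) (D : Set α) : Prop :=
  ∀ A, MeasurableSet A → A ⊆ Dᶜ → μ A = 0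

theorem IsDeterminationSet.map {α β : Type u} [MeasurableSpace α] [MeasurableSpace β]
    {μ : SignedMeasure α} {D : Set α} {E : Set β} (h : IsDeterminationSet μ D) {f : α → β}
    (hf : Measurable f) (hE : Set.MapsTo f D E) : IsDeterminationSet (μ.map f) E := by
  intro A hA hAE
  rw [VectorMeasure.map_apply _ hf hA]
  exact h _ (hf hA) fun x hx hD => hAE hx (hE hD)

/-- The signed measures with (not necessarily measurable) determination set `D`. -/
def determinedBy {α : Type u} [MeasurableSpace α] (D : Set α) : Submodule ℝ (SignedMeasure α) where
  carrier := {μ | IsDeterminationSet μ D}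
  zero_mem' := fun _ _ _ => rfl
  add_mem' := fun {μ ν} hμ hν A hA hAD => by
    rw [add_apply, hμ A hA hAD, hν A hA hAD, add_zero]
  smul_mem' := fun c μ hμ A hA hAD => by
    rw [smul_apply, hμ A hA hAD, smul_zero]

/-- `𝒞_k(X)`: the signed measures on `map(Δ^k, X)` that have a compact determination set.
(A `SignedMeasure` is real-valued, hence of finite total variation; `IsCompact` does not include
the Hausdorff property.) -/
def measureChains (X : Type u) [TopologicalSpace X] (k : ℕ) :
    Submodule ℝ (SignedMeasure (SingularSimplex k X)) where
  carrier := {μ | ∃ K, IsCompact K ∧ IsDeterminationSet μ K}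
  zero_mem' := ⟨∅, isCompact_empty, fun _ _ _ => rfl⟩
  add_mem' := by
    rintro μ ν ⟨K, hK, hμ⟩ ⟨L, hL, hν⟩
    refine ⟨K ∪ L, hK.union hL, fun A hA hAD => ?_⟩
    rw [add_apply, hμ A hA fun x hx h => hAD hx (Or.inl h),
      hν A hA fun x hx h => hAD hx (Or.inr h), add_zero]
  smul_mem' := by
    rintro c μ ⟨K, hK, hμ⟩
    exact ⟨K, hK, (determinedBy K).smul_mem c hμ⟩

/-- `𝒞_k^{x₀}(X)`: the measure chains that vanish on each measurable subset of the complement of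
`S_k^{x₀}(X)`. -/
def pointedMeasureChains (X : Type u) [TopologicalSpace X] (x₀ : X) (k : ℕ) :
    Submodule ℝ (SignedMeasure (SingularSimplex k X)) :=
  measureChains X k ⊓ determinedBy (pointedSimplices X x₀ k)

/-- The boundary operator `∂ = ∑ᵢ (-1)^i (∂ᵢ)_*` on signed measures on spaces of simplices. -/
def boundary (X : Type u) [TopologicalSpace X] (k : ℕ) :
    SignedMeasure (SingularSimplex (k + 1) X) →ₗ[ℝ] SignedMeasure (SingularSimplex k X) :=
  ∑ i : Fin (k + 2), (-1 : ℝ) ^ (i : ℕ) • VectorMeasure.mapₗ (face i)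

theorem boundary_apply {X : Type u} [TopologicalSpace X] {k : ℕ}
    (μ : SignedMeasure (SingularSimplex (k + 1) X)) :
    boundary X k μ = ∑ i : Fin (k + 2), (-1 : ℝ) ^ (i : ℕ) • μ.map (face i) := by
  simp [boundary, LinearMap.sum_apply, VectorMeasure.mapₗ]

theorem map_face_face {X : Type u} [TopologicalSpace X] {k : ℕ} (i j : Fin (k + 2)) (h : i ≤ j)
    (μ : SignedMeasure (SingularSimplex (k + 2) X)) :
    (μ.map (face j.succ)).map (face i) = (μ.map (face i.castSucc)).map (face j) := by
  ext A hA
  rw [VectorMeasure.map_apply _ (measurable_face _) hA,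
    VectorMeasure.map_apply _ (measurable_face _) (measurable_face _ hA),
    VectorMeasure.map_apply _ (measurable_face _) hA,
    VectorMeasure.map_apply _ (measurable_face _) (measurable_face _ hA)]
  congr 1
  ext σ
  simp only [Set.mem_preimage, face_face i j h]

theorem boundary_boundary {X : Type u} [TopologicalSpace X] {k : ℕ}
    (μ : SignedMeasure (SingularSimplex (k + 2) X)) :
    boundary X k (boundary X (k + 1) μ) = 0 := by
  rw [boundary_apply μ, ← alternating_double_sum
    (fun (i : Fin (k + 2)) (j : Fin (k + 3)) => (μ.map (face j)).map (face i))
    (fun i j h => map_face_face i j h μ), Finset.sum_comm, map_sum]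
  refine Finset.sum_congr rfl fun j _ => ?_
  rw [map_smul, boundary_apply, Finset.smul_sum]
  refine Finset.sum_congr rfl fun i _ => ?_
  rw [smul_smul, mul_comm]

theorem boundary_mem_measureChains {X : Type u} [TopologicalSpace X] {k : ℕ}
    {μ : SignedMeasure (SingularSimplex (k + 1) X)} (h : μ ∈ measureChains X (k + 1)) :
    boundary X k μ ∈ measureChains X k := by
  obtain ⟨K, hK, hμ⟩ := h
  rw [boundary_apply]
  exact Submodule.sum_mem _ fun i _ => Submodule.smul_mem _ _
    ⟨face i '' K, hK.image (continuous_face i), hμ.map (measurable_face i) (Set.mapsTo_image _ _)⟩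

theorem boundary_mem_pointedMeasureChains {X : Type u} [TopologicalSpace X] {x₀ : X} {k : ℕ}
    {μ : SignedMeasure (SingularSimplex (k + 1) X)} (h : μ ∈ pointedMeasureChains X x₀ (k + 1)) :
    boundary X k μ ∈ pointedMeasureChains X x₀ k := by
  refine ⟨boundary_mem_measureChains h.1, ?_⟩
  have hμ : IsDeterminationSet μ (pointedSimplices X x₀ (k + 1)) := h.2
  rw [boundary_apply]
  exact Submodule.sum_mem _ fun i _ => Submodule.smul_mem _ _
    (hμ.map (measurable_face i) fun _ hσ => face_mem_pointedSimplices i hσ)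

/-- `(𝒞_*(X), ∂)`, the complex of measure chains. -/
def measureComplex (X : Type u) [TopologicalSpace X] : ChainComplex (ModuleCat.{u} ℝ) ℕ :=
  ChainComplex.of (fun k => ModuleCat.of ℝ (measureChains X k))
    (fun k => ModuleCat.ofHom ((boundary X k).restrict fun _ h => boundary_mem_measureChains h))
    (fun k => by
      ext μ : 2
      exact Subtype.ext (boundary_boundary μ.1))

/-- `(𝒞_*^{x₀}(X), ∂)`, the complex of measure chains supported on simplices with all vertices
in `x₀`. -/
def pointedMeasureComplex (X : Type u) [TopologicalSpace X] (x₀ : X) :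
    ChainComplex (ModuleCat.{u} ℝ) ℕ :=
  ChainComplex.of (fun k => ModuleCat.of ℝ (pointedMeasureChains X x₀ k))
    (fun k => ModuleCat.ofHom
      ((boundary X k).restrict fun _ h => boundary_mem_pointedMeasureChains h))
    (fun k => by
      ext μ : 2
      exact Subtype.ext (boundary_boundary μ.1))

theorem measureComplex_d (X : Type u) [TopologicalSpace X] (k : ℕ) :
    (measureComplex X).d (k + 1) k = ModuleCat.ofHom
      ((boundary X k).restrict fun _ h => boundary_mem_measureChains h) := by
  unfold measureComplex
  dsimp only [ChainComplex.of]
  exact ChainComplex.of_d _ _ _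

theorem pointedMeasureComplex_d (X : Type u) [TopologicalSpace X] (x₀ : X) (k : ℕ) :
    (pointedMeasureComplex X x₀).d (k + 1) k = ModuleCat.ofHom
      ((boundary X k).restrict fun _ h => boundary_mem_pointedMeasureChains h) := by
  unfold pointedMeasureComplex
  dsimp only [ChainComplex.of]
  exact ChainComplex.of_d _ _ _

/-- The inclusion `ι : 𝒞_*^{x₀}(X) → 𝒞_*(X)`. -/
def measureInclusion (X : Type u) [TopologicalSpace X] (x₀ : X) :
    pointedMeasureComplex X x₀ ⟶ measureComplex X :=
  ChainComplex.ofHom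
    (fun k => ModuleCat.ofHom
      (Submodule.inclusion (inf_le_left : pointedMeasureChains X x₀ k ≤ measureChains X k)))
    (fun k => by
      rw [measureComplex_d, pointedMeasureComplex_d]
      rfl)

/-- The measure `k`-cycles of `X`, as a subspace of the space of signed measures; every measure
`0`-chain is a cycle. -/
def measureCycles (X : Type u) [TopologicalSpace X] :
    ∀ k, Submodule ℝ (SignedMeasure (SingularSimplex k X))
  | 0 => measureChains X 0
  | k + 1 => measureChains X (k + 1) ⊓ LinearMap.ker (boundary X k)

/-- The measure `k`-boundaries `∂(𝒞_{k+1}(X))`. -/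
def measureBoundaries (X : Type u) [TopologicalSpace X] (k : ℕ) :
    Submodule ℝ (SignedMeasure (SingularSimplex k X)) :=
  (measureChains X (k + 1)).map (boundary X k)

/-! ### Bounded and measurable cohomology -/

/-- A sequence of topological spaces with continuous face maps that satisfy the simplicial
identities. -/
structure SemisimplicialSpace where
  obj : ℕ → Type u
  top : ∀ k, TopologicalSpace (obj k)
  face : ∀ {k : ℕ}, Fin (k + 2) → obj (k + 1) → obj k
  continuous_face : ∀ {k : ℕ} (i : Fin (k + 2)), Continuous (face i : obj (k + 1) → obj k)
  face_face : ∀ {k : ℕ} (i j : Fin (k + 2)), i ≤ j → ∀ σ : obj (k + 2),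
    face i (face j.succ σ) = face j (face i.castSucc σ)

instance (T : SemisimplicialSpace.{u}) (k : ℕ) : TopologicalSpace (T.obj k) := T.top k

/-- All `σ`-algebras on spaces of simplices are the Borel ones. -/
instance (T : SemisimplicialSpace.{u}) (k : ℕ) : MeasurableSpace (T.obj k) := borel _

instance (T : SemisimplicialSpace.{u}) (k : ℕ) : BorelSpace (T.obj k) := ⟨rfl⟩

/-- The spaces `S_k(X) = map(Δ^k, X)`, with the compact-open topology. -/
def singularSpace (X : Type u) [TopologicalSpace X] : SemisimplicialSpace.{u} where
  obj k := SingularSimplex k X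
  top _ := inferInstance
  face := face
  continuous_face := continuous_face
  face_face := face_face

/-- The spaces `S_k^{x₀}(X)`, with the subspace topology. -/
def pointedSpace (X : Type u) [TopologicalSpace X] (x₀ : X) : SemisimplicialSpace.{u} where
  obj k := pointedSimplices X x₀ k
  top _ := inferInstance
  face i σ := ⟨face i σ.1, face_mem_pointedSimplices i σ.2⟩
  continuous_face i := ((continuous_face i).comp continuous_subtype_val).subtype_mk _
  face_face i j h σ := Subtype.ext (face_face i j h σ.1)

/-- The coboundary operator `(δ f)(σ) = ∑ᵢ (-1)^i f(∂ᵢ σ)`. -/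
def coboundary (T : SemisimplicialSpace.{u}) (k : ℕ) :
    (T.obj k → ℝ) →ₗ[ℝ] (T.obj (k + 1) → ℝ) where
  toFun f σ := ∑ i : Fin (k + 2), (-1 : ℝ) ^ (i : ℕ) * f (T.face i σ)
  map_add' f g := by
    funext σ
    simp [mul_add, Finset.sum_add_distrib]
  map_smul' c f := by
    funext σ
    simp [Finset.mul_sum, mul_left_comm]

theorem coboundary_coboundary (T : SemisimplicialSpace.{u}) {k : ℕ} (f : T.obj k → ℝ) :
    coboundary T (k + 1) (coboundary T k f) = 0 := by
  funext σ
  change ∑ j : Fin (k + 3), (-1 : ℝ) ^ (j : ℕ) *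
    ∑ i : Fin (k + 2), (-1 : ℝ) ^ (i : ℕ) * f (T.face i (T.face j σ)) = 0
  rw [← alternating_double_sum
    (fun (i : Fin (k + 2)) (j : Fin (k + 3)) => f (T.face i (T.face j σ)))
    (fun i j h => congrArg f (T.face_face i j h σ)), Finset.sum_comm]
  refine Finset.sum_congr rfl fun j _ => ?_
  rw [Finset.mul_sum]
  refine Finset.sum_congr rfl fun i _ => ?_
  rw [smul_eq_mul]
  ring

/-- The bounded functions on a type. -/
def boundedFunctions (α : Type u) : Submodule ℝ (α → ℝ) where
  carrier := {f | ∃ C : ℝ, ∀ a, |f a| ≤ C}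
  zero_mem' := ⟨0, fun a => by simp⟩
  add_mem' := by
    rintro f g ⟨C, hC⟩ ⟨D, hD⟩
    exact ⟨C + D, fun a => (abs_add_le _ _).trans (add_le_add (hC a) (hD a))⟩
  smul_mem' := by
    rintro c f ⟨C, hC⟩
    refine ⟨|c| * C, fun a => ?_⟩
    rw [Pi.smul_apply, smul_eq_mul, abs_mul]
    exact mul_le_mul_of_nonneg_left (hC a) (abs_nonneg c)

/-- The measurable functions on a measurable space. -/
def measurableFunctions (α : Type u) [MeasurableSpace α] : Submodule ℝ (α → ℝ) where
  carrier := {f | Measurable f}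
  zero_mem' := measurable_const
  add_mem' := fun hf hg => Measurable.add hf hg
  smul_mem' := fun c _ hf => Measurable.const_smul hf c

/-- The three kinds of cochains. -/
inductive CochainKind
  | bounded
  | measurable
  | measurableBounded

/-- The cochains of the given kind on a space of simplices. -/
def CochainKind.functions (κ : CochainKind) (α : Type u) [MeasurableSpace α] :
    Submodule ℝ (α → ℝ) :=
  match κ with
  | bounded => boundedFunctions α
  | measurable => measurableFunctions α
  | measurableBounded => boundedFunctions α ⊓ measurableFunctions α

theorem CochainKind.comp_mem (κ : CochainKind) {α β : Type u} [MeasurableSpace α]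
    [MeasurableSpace β] {f : β → ℝ} (hf : f ∈ κ.functions β) {g : α → β} (hg : Measurable g) :
    f ∘ g ∈ κ.functions α := by
  have hb : f ∈ boundedFunctions β → f ∘ g ∈ boundedFunctions α :=
    fun ⟨C, hC⟩ => ⟨C, fun a => hC (g a)⟩
  have hm : f ∈ measurableFunctions β → f ∘ g ∈ measurableFunctions α :=
    fun h => Measurable.comp h hg
  cases κ with
  | bounded => exact hb hf
  | measurable => exact hm hf
  | measurableBounded => exact ⟨hb hf.1, hm hf.2⟩

theorem coboundary_mem (κ : CochainKind) (T : SemisimplicialSpace.{u}) {k : ℕ} {f : T.obj k → ℝ}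
    (hf : f ∈ κ.functions (T.obj k)) : coboundary T k f ∈ κ.functions (T.obj (k + 1)) := by
  have : coboundary T k f = ∑ i : Fin (k + 2), (-1 : ℝ) ^ (i : ℕ) • (f ∘ T.face i) := by
    funext σ
    simp [coboundary, Finset.sum_apply]
  rw [this]
  exact Submodule.sum_mem _ fun i _ => Submodule.smul_mem _ _
    (κ.comp_mem hf (T.continuous_face i).measurable)

/-- The complex of real cochains of the given kind: bounded, measurable, or bounded and
measurable functions on the spaces of simplices. -/
def cochainComplex (κ : CochainKind) (T : SemisimplicialSpace.{u}) :
    CochainComplex (ModuleCat.{u} ℝ) ℕ :=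
  CochainComplex.of (fun k => ModuleCat.of ℝ (κ.functions (T.obj k)))
    (fun k => ModuleCat.ofHom ((coboundary T k).restrict fun _ h => coboundary_mem κ T h))
    (fun k => by
      ext f : 2
      exact Subtype.ext (coboundary_coboundary T f.1))

theorem cochainComplex_d (κ : CochainKind) (T : SemisimplicialSpace.{u}) (k : ℕ) :
    (cochainComplex κ T).d k (k + 1) = ModuleCat.ofHom
      ((coboundary T k).restrict fun _ h => coboundary_mem κ T h) := by
  unfold cochainComplex
  dsimp only [CochainComplex.of]
  exact CochainComplex.of_d _ _ _

/-- The inclusion `S_k^{x₀}(X) → S_k(X)`. -/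
def pointedInclusion (X : Type u) [TopologicalSpace X] (x₀ : X) (k : ℕ) :
    (pointedSpace X x₀).obj k → (singularSpace X).obj k :=
  Subtype.val

theorem continuous_pointedInclusion (X : Type u) [TopologicalSpace X] (x₀ : X) (k : ℕ) :
    Continuous (pointedInclusion X x₀ k) :=
  continuous_subtype_val

theorem measurable_pointedInclusion (X : Type u) [TopologicalSpace X] (x₀ : X) (k : ℕ) :
    Measurable (pointedInclusion X x₀ k) :=
  (continuous_pointedInclusion X x₀ k).measurable

/-- The restriction of cochains from `S_*(X)` to `S_*^{x₀}(X)`. -/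
def restriction (κ : CochainKind) (X : Type u) [TopologicalSpace X] (x₀ : X) :
    cochainComplex κ (singularSpace X) ⟶ cochainComplex κ (pointedSpace X x₀) :=
  CochainComplex.ofHom
    (fun k => ModuleCat.ofHom
      ((LinearMap.funLeft ℝ ℝ (pointedInclusion X x₀ k)).restrict
        fun _ h => κ.comp_mem h (measurable_pointedInclusion X x₀ k)))
    (fun k => by
      rw [cochainComplex_d, cochainComplex_d]
      rfl)

/-- `A` is contractible in `X`: the inclusion `A → X` is homotopic to a constant map. -/
def ContractibleIn {X : Type u} [TopologicalSpace X] (A : Set X) : Prop :=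
  (⟨Subtype.val, continuous_subtype_val⟩ : C(A, X)).Nullhomotopic

end MeasureHomology

end

/-!
Choose a path `γ_x` from each `x : X` to `x₀`, by means of contractions of the closures of the `U i`
and the Borel partition of `X` that the `U i` define (`PathSystem`). Pushing the vertices of a
singular simplex along these paths (`push`) gives a homotopy that is compatible with faces, from
each simplex `σ` to a simplex with all vertices in `x₀`. Its restrictions to the simplices of the
prism decomposition of `Δ^k × [0, 1]` are maps `S_k(X) → S_(k+1)(X)` that satisfy the identities of
a semisimplicial homotopy (`PrismOperators`) and preserve the simplices with all vertices in `x₀`.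

These maps are not continuous, since the choice of the paths is not, but they factor as a continuous
map after `PathSystem.lift`, which attaches the chosen paths to a simplex. On each of the finitely
many Borel sets of simplices whose vertices lie in given pieces of the partition, `lift` agrees with
a continuous map that is defined on a closed set of simplices. Hence the prism operators are Borel
(`measurable_comp_lift`), and they map compact sets into compact sets (`exists_isCompact_lift`). So
they act on measurable cochains, on bounded cochains and on measure chains, and the alternating sum
over them (`alternating_prism_sum`) is a homotopy from the identity to the map that is induced by
the end of `push`, on `X` as well as on the simplices with all vertices in `x₀`. This gives the
homologous cycles and the isomorphisms in cohomology, and a homotopy inverse of `ι`.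

The end of `push` reparametrizes a simplex whose vertices already lie in `x₀`, so this homotopy
inverse is not a strict retraction. But `ι` is degreewise a split monomorphism of real vector
spaces, so it can be corrected to one (`exists_retraction_of_homotopy`).
-/

noncomputable section

namespace MeasureHomology

universe u v w

/-! ### Homological algebra -/

/-- The formula `alternating_prism_sum` for families that are indexed by natural numbers: in the
double sum of the `F i j` the terms with `j < i` and with `j > i + 1` cancel against the `G i j`,
and the terms with `j = i` and `j = i + 1` telescope. -/
theorem sum_range_prism {M : Type*} [AddCommGroup M] [Module ℝ M] (n : ℕ) (F G : ℕ → ℕ → M)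
    (hlow : ∀ i j, i ≤ n → j ≤ i → F (i + 1) j = G i j)
    (hdiag : ∀ i, i ≤ n → F (i + 1) (i + 1) = F i (i + 1))
    (hhigh : ∀ i j, i < j → j ≤ n + 1 → F i (j + 1) = G i j) :
    ∑ i ∈ Finset.range (n + 2), ∑ j ∈ Finset.range (n + 3), ((-1 : ℝ) ^ i * (-1 : ℝ) ^ j) • F i j
      + ∑ i ∈ Finset.range (n + 1), ∑ j ∈ Finset.range (n + 2),
        ((-1 : ℝ) ^ i * (-1 : ℝ) ^ j) • G i j
      = F 0 0 - F (n + 1) (n + 2) := by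
  have hF : ∀ i ∈ Finset.range (n + 2),
      ∑ j ∈ Finset.range (n + 3), ((-1 : ℝ) ^ i * (-1 : ℝ) ^ j) • F i j =
        (∑ j ∈ Finset.range i, ((-1 : ℝ) ^ i * (-1 : ℝ) ^ j) • F i j) + (F i i - F i (i + 1)) +
        ∑ j ∈ Finset.Ico (i + 1) (n + 2), ((-1 : ℝ) ^ i * (-1 : ℝ) ^ (j + 1)) • F i (j + 1) := by
    intro i hi
    have hi : i < n + 2 := Finset.mem_range.mp hi
    have hsq : (-1 : ℝ) ^ i * (-1 : ℝ) ^ i = 1 := by rw [← mul_pow]; simp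
    rw [← Finset.sum_range_add_sum_Ico _ (show i + 2 ≤ n + 3 by lia), Finset.sum_range_succ,
      Finset.sum_range_succ, ← Finset.sum_Ico_add' _ (i + 1) (n + 2) 1, pow_succ _ i, ← mul_assoc,
      hsq]
    simp only [one_smul, one_mul, neg_smul]
    abel
  have hG : ∀ i ∈ Finset.range (n + 1),
      ∑ j ∈ Finset.range (n + 2), ((-1 : ℝ) ^ i * (-1 : ℝ) ^ j) • G i j =
        - (∑ j ∈ Finset.range (i + 1), ((-1 : ℝ) ^ (i + 1) * (-1 : ℝ) ^ j) • F (i + 1) j) -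
        ∑ j ∈ Finset.Ico (i + 1) (n + 2), ((-1 : ℝ) ^ i * (-1 : ℝ) ^ (j + 1)) • F i (j + 1) := by
    intro i hi
    have hi : i < n + 1 := Finset.mem_range.mp hi
    rw [← Finset.sum_range_add_sum_Ico _ (show i + 1 ≤ n + 2 by lia), sub_eq_add_neg,
      ← Finset.sum_neg_distrib, ← Finset.sum_neg_distrib]
    congr 1
    · refine Finset.sum_congr rfl fun j hj => ?_
      rw [hlow i j (by lia) (by simpa [Nat.lt_succ_iff] using hj), pow_succ, ← neg_smul]
      ring_nf
    · refine Finset.sum_congr rfl fun j hj => ?_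
      rw [Finset.mem_Ico] at hj
      rw [hhigh i j (by lia) (by lia), pow_succ, ← neg_smul]
      ring_nf
  have htel : ∑ i ∈ Finset.range (n + 2), (F i i - F i (i + 1)) = F 0 0 - F (n + 1) (n + 2) := by
    rw [Finset.sum_sub_distrib, Finset.sum_range_succ' (fun i => F i i),
      Finset.sum_range_succ (fun i => F i (i + 1)),
      Finset.sum_congr rfl fun i hi => hdiag i (by simpa [Nat.lt_succ_iff] using hi)]
    abel
  rw [Finset.sum_congr rfl hF, Finset.sum_congr rfl hG, Finset.sum_add_distrib,
    Finset.sum_add_distrib, htel, Finset.sum_sub_distrib, Finset.sum_neg_distrib,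
    Finset.sum_range_succ' (fun i => ∑ j ∈ Finset.range i, _),
    Finset.sum_range_succ (fun i => ∑ j ∈ Finset.Ico (i + 1) (n + 2), _) (n + 1)]
  simp only [Finset.Ico_self, Finset.range_zero, Finset.sum_empty]
  abel

/-- The double sum behind the fact that prism operators form a chain homotopy: `F i j` is the
`j`-th face of the `i`-th prism operator, and `G i j` is the `i`-th prism operator after the `j`-th
face. -/
theorem alternating_prism_sum {M : Type*} [AddCommGroup M] [Module ℝ M] {n : ℕ}
    (F : Fin (n + 2) → Fin (n + 3) → M) (G : Fin (n + 1) → Fin (n + 2) → M)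
    (hlow : ∀ (i : Fin (n + 1)) (j : Fin (n + 2)), j ≤ i.castSucc → F i.succ j.castSucc = G i j)
    (hdiag : ∀ i : Fin (n + 1), F i.succ i.succ.castSucc = F i.castSucc i.succ.castSucc)
    (hhigh : ∀ (i : Fin (n + 1)) (j : Fin (n + 2)), i.castSucc < j →
      F i.castSucc j.succ = G i j) :
    ∑ i : Fin (n + 2), ∑ j : Fin (n + 3), ((-1 : ℝ) ^ (i : ℕ) * (-1 : ℝ) ^ (j : ℕ)) • F i j
      + ∑ i : Fin (n + 1), ∑ j : Fin (n + 2), ((-1 : ℝ) ^ (i : ℕ) * (-1 : ℝ) ^ (j : ℕ)) • G i j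
      = F 0 0 - F (Fin.last _) (Fin.last _) := by
  let F' : ℕ → ℕ → M := fun i j => if h : i < n + 2 ∧ j < n + 3 then F ⟨i, h.1⟩ ⟨j, h.2⟩ else 0
  let G' : ℕ → ℕ → M := fun i j => if h : i < n + 1 ∧ j < n + 2 then G ⟨i, h.1⟩ ⟨j, h.2⟩ else 0
  have hF' : ∀ (i : Fin (n + 2)) (j : Fin (n + 3)), F i j = F' i j := fun i j => by
    simp only [F', dif_pos (And.intro i.isLt j.isLt)]
  have hG' : ∀ (i : Fin (n + 1)) (j : Fin (n + 2)), G i j = G' i j := fun i j => by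
    simp only [G', dif_pos (And.intro i.isLt j.isLt)]
  have key := sum_range_prism n F' G'
    (fun i j hi hj => by
      have := hlow ⟨i, by lia⟩ ⟨j, by lia⟩ (by simpa [Fin.le_def] using hj)
      rwa [hF', hG'] at this)
    (fun i hi => by
      have := hdiag ⟨i, by lia⟩
      rwa [hF', hF'] at this)
    (fun i j hi hj => by
      have := hhigh ⟨i, by lia⟩ ⟨j, by lia⟩ (by simpa [Fin.lt_def] using hi)
      rwa [hF', hG'] at this)
  simp only [hF', hG']
  simp only [Finset.sum_range] at key
  exact key

/-- A homotopy inverse of a degreewise split monomorphism `ι` can be corrected to a strict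
retraction: extend the homotopy `ι ≫ η' ≃ 𝟙` along `ι` and subtract the null-homotopic map that it
defines. -/
theorem exists_retraction_of_homotopy {V : Type u} [Category.{v} V] [Preadditive V] {I : Type w}
    {c : ComplexShape I} {C D : HomologicalComplex V c} (ι : C ⟶ D) (r : ∀ i, D.X i ⟶ C.X i)
    (hr : ∀ i, ι.f i ≫ r i = 𝟙 _) (η' : D ⟶ C) (s : Homotopy (η' ≫ ι) (𝟙 D))
    (s' : Homotopy (ι ≫ η') (𝟙 C)) :
    ∃ η : D ⟶ C, ι ≫ η = 𝟙 C ∧ Nonempty (Homotopy (η ≫ ι) (𝟙 D)) := by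
  let h : ∀ i j, D.X i ⟶ C.X j := fun i j => r i ≫ s'.hom i j
  have hz : ∀ i j, ¬ c.Rel j i → h i j = 0 := fun i j hij => by simp [h, s'.zero i j hij]
  have hs' : Homotopy.nullHomotopicMap s'.hom = ι ≫ η' - 𝟙 C := by
    ext i
    simpa [Homotopy.nullHomotopicMap] using (eq_sub_of_add_eq (s'.comm i).symm)
  have hι : ι ≫ Homotopy.nullHomotopicMap h = ι ≫ η' - 𝟙 C := by
    rw [Homotopy.comp_nullHomotopicMap, ← hs']
    congr 1
    funext i j
    rw [← Category.assoc, hr, Category.id_comp]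
  refine ⟨η' - Homotopy.nullHomotopicMap h, by rw [Preadditive.comp_sub, hι, sub_sub_cancel], ⟨?_⟩⟩
  have hη : Homotopy (η' - Homotopy.nullHomotopicMap h) η' := by
    refine (Homotopy.equivSubZero.symm ?_).symm
    rw [sub_sub_cancel]
    exact Homotopy.nullHomotopy h hz
  exact (hη.compRight ι).trans s

/-! ### Affine maps from simplices to cylinders -/

theorem map_apply_of_injective {m k : ℕ} {f : Fin m → Fin k} (hf : Function.Injective f)
    (p : stdSimplex ℝ (Fin m)) (x : Fin m) : stdSimplex.map f p (f x) = p x := by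
  rw [stdSimplex.map_coe, FunOnFinite.linearMap_apply_apply]
  rw [Finset.sum_eq_single_of_mem x (by simp)]
  intro y hy hyx
  exact absurd (hf (Finset.mem_filter.mp hy).2) hyx

theorem faceInclusion_succAbove {k : ℕ} (a : Fin (k + 2)) (p : StdSimplex k) (x : Fin (k + 1)) :
    faceInclusion k a p (a.succAbove x) = p x :=
  map_apply_of_injective Fin.succAbove_right_injective p x

theorem faceInclusion_self {k : ℕ} (a : Fin (k + 2)) (p : StdSimplex k) :
    faceInclusion k a p a = 0 := by
  change stdSimplex.map a.succAbove p a = 0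
  rw [stdSimplex.map_coe, FunOnFinite.linearMap_apply_apply, Finset.sum_eq_zero]
  intro y hy
  exact absurd (Finset.mem_filter.mp hy).2 (Fin.succAbove_ne a y)

theorem sum_map_mul {m k : ℕ} (f : Fin m → Fin k) (c : Fin k → ℝ) (p : stdSimplex ℝ (Fin m)) :
    ∑ y, stdSimplex.map f p y * c y = ∑ x, p x * c (f x) := by
  simp only [stdSimplex.map_coe, FunOnFinite.linearMap_apply_apply, Finset.sum_mul]
  rw [← Finset.sum_fiberwise Finset.univ f]
  refine Finset.sum_congr rfl fun y _ => Finset.sum_congr rfl fun x hx => ?_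
  rw [(Finset.mem_filter.mp hx).2]

/-- The affine map `Δ^m → Δ^k × [0, 1]` that sends the vertex `v_x` to `(v_(f x), c x)`. -/
def toCylinder {m k : ℕ} (f : Fin (m + 1) → Fin (k + 1)) (c : Fin (m + 1) → unitInterval) :
    C(StdSimplex m, StdSimplex k × unitInterval) where
  toFun p := (stdSimplex.map f p, ⟨∑ x, p x * (c x : ℝ),
    Finset.sum_nonneg fun x _ => mul_nonneg (p.2.1 x) (c x).2.1,
    (Finset.sum_le_sum fun x _ => mul_le_of_le_one_right (p.2.1 x) (c x).2.2).trans_eq p.2.2⟩)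
  continuous_toFun := by
    refine (stdSimplex.continuous_map f).prodMk (Continuous.subtype_mk ?_ _)
    exact continuous_finsetSum _ fun x _ =>
      ((continuous_apply x).comp continuous_subtype_val).mul continuous_const

theorem toCylinder_faceInclusion {m k : ℕ} (f : Fin (m + 2) → Fin (k + 1))
    (c : Fin (m + 2) → unitInterval) (a : Fin (m + 2)) (p : StdSimplex m) :
    toCylinder f c (faceInclusion m a p) = toCylinder (f ∘ a.succAbove) (c ∘ a.succAbove) p :=
  Prod.ext (stdSimplex.map_comp_apply _ _ _) (Subtype.ext (sum_map_mul _ _ _))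

theorem faceInclusion_toCylinder {m k : ℕ} (f : Fin (m + 1) → Fin (k + 1))
    (c : Fin (m + 1) → unitInterval) (a : Fin (k + 2)) (p : StdSimplex m) :
    (faceInclusion k a (toCylinder f c p).1, (toCylinder f c p).2) =
      toCylinder (a.succAbove ∘ f) c p :=
  Prod.ext (stdSimplex.map_comp_apply _ _ _) rfl

theorem toCylinder_vertex {m k : ℕ} (f : Fin (m + 1) → Fin (k + 1))
    (c : Fin (m + 1) → unitInterval) (x : Fin (m + 1)) :
    toCylinder f c (vertex m x) = (vertex k (f x), c x) := by
  refine Prod.ext (stdSimplex.map_vertex f x) (Subtype.ext ?_)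
  change ∑ y, (stdSimplex.vertex (S := ℝ) x) y * (c y : ℝ) = c x
  simp [Pi.single_apply]

theorem toCylinder_id_const {k : ℕ} (t : unitInterval) (p : StdSimplex k) :
    toCylinder id (fun _ => t) p = (p, t) := by
  refine Prod.ext (stdSimplex.map_id_apply p) (Subtype.ext ?_)
  change ∑ y, p y * (t : ℝ) = t
  rw [← Finset.sum_mul, stdSimplex.sum_eq_one, one_mul]

/-- The `i`-th simplex `Δ^(k+1) → Δ^k × [0, 1]` of the prism decomposition of the cylinder, with
vertices `(v_0, 0), …, (v_i, 0), (v_i, 1), …, (v_k, 1)`. -/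
def prism {k : ℕ} (i : Fin (k + 1)) : C(StdSimplex (k + 1), StdSimplex k × unitInterval) :=
  toCylinder i.predAbove fun x => if x ≤ i.castSucc then 0 else 1

theorem val_predAbove {k : ℕ} (i : Fin (k + 1)) (x : Fin (k + 2)) :
    (i.predAbove x : ℕ) = if (i : ℕ) < x then (x : ℕ) - 1 else x := by
  simp only [Fin.predAbove, Fin.lt_def, Fin.val_castSucc]
  split_ifs <;> rfl

theorem val_succAbove {k : ℕ} (a : Fin (k + 2)) (x : Fin (k + 1)) :
    (a.succAbove x : ℕ) = if (x : ℕ) < a then (x : ℕ) else x + 1 := by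
  simp only [Fin.succAbove, Fin.lt_def, Fin.val_castSucc]
  split_ifs <;> rfl

theorem prism_zero_face {k : ℕ} (p : StdSimplex k) :
    prism 0 (faceInclusion k 0 p) = (p, 1) := by
  rw [prism, toCylinder_faceInclusion, ← toCylinder_id_const]
  congr 1

theorem prism_last_face {k : ℕ} (p : StdSimplex k) :
    prism (Fin.last k) (faceInclusion k (Fin.last _) p) = (p, 0) := by
  rw [prism, toCylinder_faceInclusion, ← toCylinder_id_const]
  congr 1
  congr 1
  · funext x
    simp
  · funext x
    simp [Fin.le_last]

theorem prism_face_of_le {k : ℕ} (i : Fin (k + 1)) (j : Fin (k + 2)) (h : j ≤ i.castSucc)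
    (p : StdSimplex (k + 1)) :
    prism i.succ (faceInclusion _ j.castSucc p) =
      (faceInclusion _ j (prism i p).1, (prism i p).2) := by
  rw [prism, prism, toCylinder_faceInclusion, faceInclusion_toCylinder]
  rw [Fin.le_def, Fin.val_castSucc] at h
  congr 1
  congr 1
  · funext x
    simp only [Function.comp_apply, val_predAbove, val_succAbove, Fin.ext_iff, Fin.val_succ,
      Fin.val_castSucc]
    split_ifs <;> omega
  · funext x
    simp only [Function.comp_apply, val_succAbove, Fin.le_def, Fin.val_succ,
      Fin.val_castSucc]
    split_ifs <;> first | rfl | omega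

theorem prism_face_of_lt {k : ℕ} (i : Fin (k + 1)) (j : Fin (k + 2)) (h : i.castSucc < j)
    (p : StdSimplex (k + 1)) :
    prism i.castSucc (faceInclusion _ j.succ p) =
      (faceInclusion _ j (prism i p).1, (prism i p).2) := by
  rw [prism, prism, toCylinder_faceInclusion, faceInclusion_toCylinder]
  rw [Fin.lt_def, Fin.val_castSucc] at h
  congr 1
  congr 1
  · funext x
    simp only [Function.comp_apply, val_predAbove, val_succAbove, Fin.ext_iff, Fin.val_succ,
      Fin.val_castSucc]
    split_ifs <;> omega
  · funext x
    simp only [Function.comp_apply, val_succAbove, Fin.le_def, Fin.val_succ,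
      Fin.val_castSucc]
    split_ifs <;> first | rfl | omega

theorem prism_face_succ {k : ℕ} (i : Fin (k + 1)) (p : StdSimplex (k + 1)) :
    prism i.succ (faceInclusion _ i.succ.castSucc p) =
      prism i.castSucc (faceInclusion _ i.succ.castSucc p) := by
  rw [prism, prism, toCylinder_faceInclusion, toCylinder_faceInclusion]
  congr 1
  congr 1
  · funext x
    simp only [Function.comp_apply, val_predAbove, val_succAbove, Fin.ext_iff, Fin.val_succ,
      Fin.val_castSucc]
    split_ifs <;> omega
  · funext x
    simp only [Function.comp_apply, val_succAbove, Fin.le_def, Fin.val_succ,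
      Fin.val_castSucc]
    split_ifs <;> first | rfl | omega

/-! ### Collapsing neighbourhoods of the vertices -/

/-- The bump function that vanishes for `u ≤ 1/2` and equals `1` for `u ≥ 3/4`. -/
def bump (u : ℝ) : ℝ := max 0 (min 1 (4 * u - 2))

theorem continuous_bump : Continuous bump := by
  unfold bump
  fun_prop

theorem bump_nonneg (u : ℝ) : 0 ≤ bump u := le_max_left _ _

theorem bump_le_one (u : ℝ) : bump u ≤ 1 := max_le zero_le_one (min_le_left _ _)

theorem bump_eq_zero {u : ℝ} (h : u ≤ 1 / 2) : bump u = 0 :=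
  max_eq_left ((min_le_right _ _).trans (by linarith))

theorem bump_eq_one {u : ℝ} (h : 3 / 4 ≤ u) : bump u = 1 := by
  rw [bump, min_eq_left (by linarith), max_eq_right zero_le_one]

theorem add_coord_le_one {k : ℕ} (p : StdSimplex k) {i j : Fin (k + 1)} (h : i ≠ j) :
    p i + p j ≤ 1 := by
  rw [← stdSimplex.sum_eq_one p, ← Finset.sum_pair h]
  exact Finset.sum_le_sum_of_subset_of_nonneg (Finset.subset_univ _) fun x _ _ => p.2.1 x

theorem sum_bump_le_one {k : ℕ} (p : StdSimplex k) : ∑ j, bump (p j) ≤ 1 := by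
  -- At most one coordinate exceeds `1/2`.
  by_cases h : ∃ j, 1 / 2 < p j
  · obtain ⟨j, hj⟩ := h
    rw [Finset.sum_eq_single_of_mem j (Finset.mem_univ j)]
    · exact bump_le_one _
    · intro i _ hi
      exact bump_eq_zero (by linarith [add_coord_le_one p hi])
  · push Not at h
    rw [Finset.sum_eq_zero fun j _ => bump_eq_zero (h j)]
    exact zero_le_one

/-- The homotopy `Δ^k × [0, 1] → Δ^k` that starts at the identity and, from time `1/2` on, sends
the neighbourhood `{p | 3/4 ≤ p_j}` of `v_j` to `v_j`, for each `j`. -/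
def collapse (k : ℕ) : C(StdSimplex k × unitInterval, StdSimplex k) where
  toFun q := ⟨fun i => (1 - min 1 (2 * (q.2 : ℝ)) * ∑ j, bump (q.1 j)) * q.1 i +
      min 1 (2 * (q.2 : ℝ)) * bump (q.1 i), by
    obtain ⟨p, t⟩ := q
    have ht : 0 ≤ min 1 (2 * (t : ℝ)) := le_min zero_le_one (by linarith [t.2.1])
    have hs : min 1 (2 * (t : ℝ)) * ∑ j, bump (p j) ≤ 1 :=
      mul_le_one₀ (min_le_left _ _) (Finset.sum_nonneg fun _ _ => bump_nonneg _)
        (sum_bump_le_one p)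
    refine ⟨fun i => add_nonneg (mul_nonneg (sub_nonneg.mpr hs) (p.2.1 i))
      (mul_nonneg ht (bump_nonneg _)), ?_⟩
    rw [Finset.sum_add_distrib, ← Finset.mul_sum, ← Finset.mul_sum, stdSimplex.sum_eq_one]
    ring⟩
  continuous_toFun := by
    have hc : ∀ i, Continuous fun q : StdSimplex k × unitInterval => q.1 i := fun i =>
      (continuous_apply i).comp (continuous_subtype_val.comp continuous_fst)
    have hb : ∀ i, Continuous fun q : StdSimplex k × unitInterval => bump (q.1 i) := fun i =>
      continuous_bump.comp (hc i)
    have ht : Continuous fun q : StdSimplex k × unitInterval => min 1 (2 * (q.2 : ℝ)) := by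
      fun_prop
    refine Continuous.subtype_mk (continuous_pi fun i => ?_) _
    exact ((continuous_const.sub (ht.mul (continuous_finsetSum _ fun j _ => hb j))).mul (hc i)).add
      (ht.mul (hb i))

theorem collapse_apply {k : ℕ} (p : StdSimplex k) (t : unitInterval) (i : Fin (k + 1)) :
    collapse k (p, t) i = (1 - min 1 (2 * (t : ℝ)) * ∑ j, bump (p j)) * p i +
      min 1 (2 * (t : ℝ)) * bump (p i) := rfl

theorem collapse_zero {k : ℕ} (p : StdSimplex k) : collapse k (p, 0) = p := by
  ext i
  rw [collapse_apply]
  simp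

theorem collapse_eq_vertex {k : ℕ} {p : StdSimplex k} {t : unitInterval} {j : Fin (k + 1)}
    (hp : 3 / 4 ≤ p j) (ht : 1 / 2 ≤ (t : ℝ)) : collapse k (p, t) = vertex k j := by
  have h0 : ∀ i, i ≠ j → bump (p i) = 0 := fun i hi =>
    bump_eq_zero (by linarith [add_coord_le_one p hi])
  ext i
  rw [collapse_apply, Finset.sum_eq_single_of_mem j (Finset.mem_univ j) fun i _ hi => h0 i hi,
    bump_eq_one hp, min_eq_left (by linarith)]
  change _ = (Pi.single j 1 : Fin (k + 1) → ℝ) i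
  by_cases hi : i = j
  · subst hi
    simp [bump_eq_one hp]
  · simp [h0 i hi, hi]

theorem collapse_face {k : ℕ} (a : Fin (k + 2)) (p : StdSimplex k) (t : unitInterval) :
    collapse (k + 1) (faceInclusion k a p, t) = faceInclusion k a (collapse k (p, t)) := by
  ext i
  rw [collapse_apply, Fin.sum_univ_succAbove _ a]
  simp only [faceInclusion_succAbove, faceInclusion_self,
    bump_eq_zero (show (0 : ℝ) ≤ 1 / 2 by norm_num), zero_add]
  obtain rfl | ⟨x, rfl⟩ := Fin.eq_self_or_eq_succAbove a i
  · simp [faceInclusion_self, bump_eq_zero]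
  · rw [faceInclusion_succAbove, faceInclusion_succAbove, collapse_apply]

/-! ### Pushing the vertices of a simplex along paths -/

section Push

variable {X : Type u} [TopologicalSpace X] {x₀ : X} {k : ℕ}

/-- A singular simplex `σ` together with a path from each vertex of `σ` to `x₀`. -/
def Whiskered (X : Type u) [TopologicalSpace X] (x₀ : X) (k : ℕ) : Type u :=
  {w : C(StdSimplex k, X) × (Fin (k + 1) → C(unitInterval, X)) //
    ∀ j, w.2 j 0 = w.1 (vertex k j) ∧ w.2 j 1 = x₀}

instance : TopologicalSpace (Whiskered X x₀ k) := instTopologicalSpaceSubtype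

/-- The path parameter at the point `(p, t)` of the cylinder, if `p_j` is the given coordinate. It
grows from `0` to `1` as `t` goes from `1/2` to `1` and the coordinate goes from `3/4` to `1`. -/
def whiskerTime (u t : ℝ) : unitInterval :=
  Set.projIcc 0 1 zero_le_one ((2 * t - 1) * (4 * u - 3))

theorem whiskerTime_eq_zero {u t : ℝ} (h : u = 3 / 4 ∨ t = 1 / 2) : whiskerTime u t = 0 := by
  have : (2 * t - 1) * (4 * u - 3) = 0 := by
    rcases h with rfl | rfl <;> norm_num
  rw [whiskerTime, this]
  exact Set.projIcc_left zero_le_one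

theorem whiskerTime_one : whiskerTime 1 1 = 1 := by
  have : ((2 : ℝ) * 1 - 1) * (4 * 1 - 3) = 1 := by norm_num
  rw [whiskerTime, this]
  exact Set.projIcc_right zero_le_one

open Classical in
/-- The homotopy of `σ` that first collapses a neighbourhood of each vertex to the vertex and then
stretches these neighbourhoods along the given paths. -/
def pushFun (w : Whiskered X x₀ k) (q : StdSimplex k × unitInterval) : X :=
  if h : ∃ j, 3 / 4 ≤ q.1 j ∧ 1 / 2 ≤ (q.2 : ℝ) then
    w.1.2 h.choose (whiskerTime (q.1 h.choose) q.2)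
  else w.1.1 (collapse k q)

theorem pushFun_whisker (w : Whiskered X x₀ k) {q : StdSimplex k × unitInterval} {j : Fin (k + 1)}
    (hp : 3 / 4 ≤ q.1 j) (ht : 1 / 2 ≤ (q.2 : ℝ)) :
    pushFun w q = w.1.2 j (whiskerTime (q.1 j) q.2) := by
  have h : ∃ j, 3 / 4 ≤ q.1 j ∧ 1 / 2 ≤ (q.2 : ℝ) := ⟨j, hp, ht⟩
  have hj : h.choose = j := by
    by_contra hne
    linarith [add_coord_le_one q.1 hne, h.choose_spec.1]
  rw [pushFun, dif_pos h, hj]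

theorem pushFun_core (w : Whiskered X x₀ k) {q : StdSimplex k × unitInterval}
    (h : (q.2 : ℝ) ≤ 1 / 2 ∨ ∀ j, q.1 j ≤ 3 / 4) : pushFun w q = w.1.1 (collapse k q) := by
  by_cases hq : ∃ j, 3 / 4 ≤ q.1 j ∧ 1 / 2 ≤ (q.2 : ℝ)
  · obtain ⟨j, hp, ht⟩ := hq
    -- On the overlap of the two regions the path is still at its starting point.
    have hz : whiskerTime (q.1 j) q.2 = 0 := whiskerTime_eq_zero <| by
      rcases h with h | h
      · exact Or.inr (le_antisymm h ht)
      · exact Or.inl (le_antisymm (h j) hp)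
    rw [pushFun_whisker w hp ht, hz, (w.2 j).1, ← collapse_eq_vertex hp ht]
  · rw [pushFun, dif_neg hq]

theorem continuous_pushFun :
    Continuous fun z : Whiskered X x₀ k × (StdSimplex k × unitInterval) => pushFun z.1 z.2 := by
  have hcoord : ∀ j, Continuous
      fun z : Whiskered X x₀ k × (StdSimplex k × unitInterval) => z.2.1 j := fun j =>
    (continuous_apply j).comp (continuous_subtype_val.comp (continuous_fst.comp continuous_snd))
  have htime : Continuous
      fun z : Whiskered X x₀ k × (StdSimplex k × unitInterval) => (z.2.2 : ℝ) := by fun_prop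
  have hval : Continuous fun z : Whiskered X x₀ k × (StdSimplex k × unitInterval) => z.1.1 :=
    continuous_subtype_val.comp continuous_fst
  let B : Option (Fin (k + 1)) → Set (Whiskered X x₀ k × (StdSimplex k × unitInterval)) :=
    fun o => o.elim {z | (z.2.2 : ℝ) ≤ 1 / 2 ∨ ∀ j, z.2.1 j ≤ 3 / 4}
      fun j => {z | 3 / 4 ≤ z.2.1 j ∧ 1 / 2 ≤ (z.2.2 : ℝ)}
  refine (locallyFinite_of_finite B).continuous ?_ ?_ ?_
  · refine Set.eq_univ_of_forall fun z => ?_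
    by_cases hz : ∃ j, 3 / 4 ≤ z.2.1 j ∧ 1 / 2 ≤ (z.2.2 : ℝ)
    · obtain ⟨j, hj⟩ := hz
      exact Set.mem_iUnion.mpr ⟨some j, hj⟩
    · refine Set.mem_iUnion.mpr ⟨none, ?_⟩
      push Not at hz
      by_cases ht : (z.2.2 : ℝ) ≤ 1 / 2
      · exact Or.inl ht
      · refine Or.inr fun j => ?_
        by_contra! hj
        exact ht (hz j hj.le).le
  · rintro (_ | j)
    · have h : IsClosed {z : Whiskered X x₀ k × (StdSimplex k × unitInterval) |
          ∀ j, z.2.1 j ≤ 3 / 4} := by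
        rw [Set.ofPred_forall]
        exact isClosed_iInter fun j => isClosed_le (hcoord j) continuous_const
      exact (isClosed_le htime continuous_const).union h
    · exact (isClosed_le continuous_const (hcoord j)).inter (isClosed_le continuous_const htime)
  · rintro (_ | j)
    · have : Continuous fun z : Whiskered X x₀ k × (StdSimplex k × unitInterval) =>
          z.1.1.1 (collapse k z.2) :=
        (continuous_fst.comp hval).eval ((collapse k).continuous.comp continuous_snd)
      exact this.continuousOn.congr fun z hz => pushFun_core z.1 hz
    · have hw : Continuous fun z : Whiskered X x₀ k × (StdSimplex k × unitInterval) =>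
          whiskerTime (z.2.1 j) z.2.2 :=
        continuous_projIcc.comp (((continuous_const.mul htime).sub continuous_const).mul
          ((continuous_const.mul (hcoord j)).sub continuous_const))
      have : Continuous fun z : Whiskered X x₀ k × (StdSimplex k × unitInterval) =>
          z.1.1.2 j (whiskerTime (z.2.1 j) z.2.2) :=
        ((continuous_apply j).comp (continuous_snd.comp hval)).eval hw
      exact this.continuousOn.congr fun z hz => pushFun_whisker z.1 hz.1 hz.2

/-- The homotopies `pushFun`, as a continuous family. -/
def push : C(Whiskered X x₀ k, C(StdSimplex k × unitInterval, X)) :=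
  ContinuousMap.curry ⟨_, continuous_pushFun⟩

theorem push_zero (w : Whiskered X x₀ k) (p : StdSimplex k) : push w (p, 0) = w.1.1 p := by
  change pushFun w (p, 0) = _
  rw [pushFun_core w (Or.inl (by norm_num)), collapse_zero]

theorem push_vertex_one (w : Whiskered X x₀ k) (j : Fin (k + 1)) :
    push w (vertex k j, 1) = x₀ := by
  change pushFun w (vertex k j, 1) = _
  have h1 : (vertex k j) j = 1 := Pi.single_eq_same (M := fun _ => ℝ) j 1
  rw [pushFun_whisker w (j := j) (by simp only [h1]; norm_num) (by norm_num)]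
  simp only [h1]
  rw [show ((1 : unitInterval) : ℝ) = 1 from rfl, whiskerTime_one]
  exact (w.2 j).2

/-- The `i`-th face of a simplex with paths attached to its vertices. -/
def Whiskered.face (i : Fin (k + 2)) (w : Whiskered X x₀ (k + 1)) : Whiskered X x₀ k :=
  ⟨(w.1.1.comp (faceInclusion k i), w.1.2 ∘ i.succAbove), fun j =>
    ⟨(w.2 _).1.trans (congrArg w.1.1 (stdSimplex.map_vertex i.succAbove j).symm), (w.2 _).2⟩⟩

theorem push_face (i : Fin (k + 2)) (w : Whiskered X x₀ (k + 1)) (p : StdSimplex k)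
    (t : unitInterval) : push (w.face i) (p, t) = push w (faceInclusion k i p, t) := by
  change pushFun (w.face i) (p, t) = pushFun w (faceInclusion k i p, t)
  by_cases h : ∃ j, 3 / 4 ≤ p j ∧ 1 / 2 ≤ (t : ℝ)
  · obtain ⟨j, hp, ht⟩ := h
    rw [pushFun_whisker (w.face i) (q := (p, t)) hp ht,
      pushFun_whisker w (q := (faceInclusion k i p, t)) (j := i.succAbove j)
        (by simpa only [faceInclusion_succAbove] using hp) ht]
    simp only [faceInclusion_succAbove]
    rfl
  · have hcore : (t : ℝ) ≤ 1 / 2 ∨ ∀ j, p j ≤ 3 / 4 := by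
      push Not at h
      by_cases ht : (t : ℝ) ≤ 1 / 2
      · exact Or.inl ht
      · refine Or.inr fun j => ?_
        by_contra! hj
        exact ht (h j hj.le).le
    rw [pushFun_core (w.face i) (q := (p, t)) hcore,
      pushFun_core w (q := (faceInclusion k i p, t)) (hcore.imp_right fun h a => ?_),
      collapse_face]
    · rfl
    · obtain rfl | ⟨x, rfl⟩ := Fin.eq_self_or_eq_succAbove i a
      · simp only [faceInclusion_self]
        norm_num
      · simpa only [faceInclusion_succAbove] using h x

end Push

/-! ### Measurable choice of the paths -/

theorem continuous_atVertex {X : Type u} [TopologicalSpace X] {k : ℕ} (j : Fin (k + 1)) :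
    Continuous fun σ : SingularSimplex k X => atVertex σ j :=
  continuous_eval_const (F := C(StdSimplex k, X)) (vertex k j)

/-- A choice of a path to `x₀` from each point of `X` that is continuous on each piece of a finite
Borel partition of `X`, and extends continuously to a closed set that contains the piece. -/
structure PathSystem (X : Type u) [TopologicalSpace X] (x₀ : X) (n : ℕ) where
  /-- The index of the piece that contains a point. -/
  idx : X → Fin n
  /-- The closed sets on which continuous choices of paths are given. -/
  Z : Fin n → Set X
  isClosed_Z : ∀ i, IsClosed (Z i)
  mem_Z : ∀ x, x ∈ Z (idx x)
  measurableSet_idx : ∀ i, @MeasurableSet X (borel X) (idx ⁻¹' {i})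
  /-- The path from a point of the `i`-th closed set to `x₀`. -/
  path : ∀ i, C(Z i, C(unitInterval, X))
  path_zero : ∀ i x, path i x 0 = x
  path_one : ∀ i x, path i x 1 = x₀

/-- A contraction of `A` in the path-connected space `X` can be continued to end in `x₀`; its tracks
are paths to `x₀` that depend continuously on their starting point. -/
theorem exists_path_of_contractibleIn {X : Type u} [TopologicalSpace X] [PathConnectedSpace X]
    (x₀ : X) {A : Set X} (hA : ContractibleIn A) :
    ∃ h : C(A, C(unitInterval, X)), ∀ x, h x 0 = x ∧ h x 1 = x₀ := by
  obtain ⟨y, ⟨F⟩⟩ := hA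
  have γ : Path y x₀ := PathConnectedSpace.somePath y x₀
  let G := F.trans (⟨γ.toContinuousMap.comp ContinuousMap.fst, fun x => γ.source,
    fun x => γ.target⟩ :
      ContinuousMap.Homotopy (ContinuousMap.const A y) (ContinuousMap.const A x₀))
  exact ⟨ContinuousMap.curry (G.toContinuousMap.comp ContinuousMap.prodSwap),
    fun x => ⟨G.apply_zero x, G.apply_one x⟩⟩

theorem nonempty_pathSystem {X : Type u} [TopologicalSpace X] [PathConnectedSpace X] {n : ℕ}
    (U : Fin n → Set X) (hcover : ⋃ i, U i = Set.univ)
    (hborel : ∀ i, @MeasurableSet X (borel X) (U i))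
    (hcontr : ∀ i, ContractibleIn (closure (U i))) (x₀ : X) : Nonempty (PathSystem X x₀ n) := by
  classical
  let : MeasurableSpace X := borel X
  have hx : ∀ x, ∃ i, x ∈ U i := fun x => Set.mem_iUnion.mp (hcover ▸ Set.mem_univ x)
  choose path hpath using fun i => exists_path_of_contractibleIn x₀ (hcontr i)
  -- The pieces of the partition are made disjoint by the choice of the least possible index.
  have hidx : ∀ x, ∃ i, x ∈ U i ∧ ∀ j < i, x ∉ U j := fun x => by
    obtain ⟨i, hi, hmin⟩ := WellFounded.has_min (wellFounded_lt (α := Fin n)) {i | x ∈ U i} (hx x)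
    exact ⟨i, hi, fun j hj hjx => hmin j hjx hj⟩
  choose idx hmem hlt using hidx
  refine ⟨⟨idx, fun i => closure (U i), fun i => isClosed_closure, fun x => subset_closure (hmem x),
    fun i => ?_, path, fun i x => (hpath i x).1, fun i x => (hpath i x).2⟩⟩
  have : idx ⁻¹' {i} = U i ∩ ⋂ j ∈ Set.Iio i, (U j)ᶜ := by
    ext x
    simp only [Set.mem_preimage, Set.mem_singleton_iff, Set.mem_inter_iff, Set.mem_iInter,
      Set.mem_compl_iff, Set.mem_Iio]
    constructor
    · rintro rfl
      exact ⟨hmem x, hlt x⟩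
    · rintro ⟨h, h'⟩
      rcases lt_trichotomy (idx x) i with hi | hi | hi
      · exact absurd (hmem x) (h' _ hi)
      · exact hi
      · exact absurd h (hlt x i hi)
  rw [this]
  exact (hborel i).inter (MeasurableSet.biInter (Set.to_countable _) fun j _ => (hborel j).compl)

namespace PathSystem

variable {X : Type u} [TopologicalSpace X] {x₀ : X} {n : ℕ} (S : PathSystem X x₀ n) {k : ℕ}

/-- The simplices whose vertices lie in the closed sets with the given indices. -/
def vertexSet (I : Fin (k + 1) → Fin n) : Set (SingularSimplex k X) :=
  {σ | ∀ j, atVertex σ j ∈ S.Z (I j)}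

/-- The attachment of paths on the set of simplices whose vertices lie in the closed sets with the
given indices. -/
def liftOn (I : Fin (k + 1) → Fin n) (σ : S.vertexSet I) : Whiskered X x₀ k :=
  ⟨(σ.1, fun j => S.path (I j) ⟨atVertex σ.1 j, σ.2 j⟩),
    fun _ => ⟨S.path_zero _ _, S.path_one _ _⟩⟩

theorem continuous_liftOn (I : Fin (k + 1) → Fin n) : Continuous (S.liftOn I) := by
  refine Continuous.subtype_mk (continuous_subtype_val.prodMk (continuous_pi fun j => ?_)) _
  exact (S.path (I j)).continuous.comp
    (((continuous_atVertex j).comp continuous_subtype_val).subtype_mk _)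

theorem isClosed_vertexSet (I : Fin (k + 1) → Fin n) : IsClosed (S.vertexSet I) := by
  rw [vertexSet, Set.ofPred_forall]
  exact isClosed_iInter fun j => (S.isClosed_Z (I j)).preimage (continuous_atVertex j)

/-- The indices of the pieces that contain the vertices of a simplex. -/
def indices (σ : SingularSimplex k X) : Fin (k + 1) → Fin n := fun j => S.idx (atVertex σ j)

theorem mem_vertexSet (σ : SingularSimplex k X) : σ ∈ S.vertexSet (S.indices σ) :=
  fun _ => S.mem_Z _

theorem measurableSet_indices (I : Fin (k + 1) → Fin n) :
    MeasurableSet {σ : SingularSimplex k X | S.indices σ = I} := by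
  let : MeasurableSpace X := borel X
  have : BorelSpace X := ⟨rfl⟩
  have : {σ : SingularSimplex k X | S.indices σ = I} =
      ⋂ j, (fun σ => atVertex σ j) ⁻¹' (S.idx ⁻¹' {I j}) := by
    ext σ
    simp [indices, funext_iff]
  rw [this]
  exact MeasurableSet.iInter fun j =>
    (continuous_atVertex j).measurable (S.measurableSet_idx (I j))

/-- The attachment of the chosen paths to the vertices of a simplex. It is not continuous, but
coincides with the continuous map `liftOn I` on the Borel set of simplices with indices `I`. -/
def lift (σ : SingularSimplex k X) : Whiskered X x₀ k :=
  S.liftOn (S.indices σ) ⟨σ, S.mem_vertexSet σ⟩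

theorem lift_face (i : Fin (k + 2)) (σ : SingularSimplex (k + 1) X) :
    S.lift (face i σ) = (S.lift σ).face i := by
  refine Subtype.ext (Prod.ext rfl (funext fun j => ?_))
  have h : ∀ {x y : X} (hxy : x = y),
      S.path (S.idx x) ⟨x, S.mem_Z x⟩ = S.path (S.idx y) ⟨y, S.mem_Z y⟩ := by
    rintro x _ rfl
    rfl
  exact h (atVertex_face i σ j)

/-- The map `lift` is Borel, since it is continuous on each set of a finite Borel partition. -/
theorem measurable_comp_lift {Y : Type*} [TopologicalSpace Y] [MeasurableSpace Y] [BorelSpace Y]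
    {f : Whiskered X x₀ k → Y} (hf : Continuous f) :
    Measurable fun σ : SingularSimplex k X => f (S.lift σ) := by
  refine measurable_of_isOpen fun V hV => ?_
  choose O hO hOV using fun I : Fin (k + 1) → Fin n =>
    isOpen_induced_iff.mp (hV.preimage (hf.comp (S.continuous_liftOn I)))
  have : (fun σ : SingularSimplex k X => f (S.lift σ)) ⁻¹' V =
      ⋃ I, {σ : SingularSimplex k X | S.indices σ = I} ∩ O I := by
    ext σ
    simp only [Set.mem_preimage, Set.mem_iUnion, Set.mem_inter_iff, Set.mem_ofPred_eq,
      exists_eq_left']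
    exact (Set.ext_iff.mp (hOV (S.indices σ)) ⟨σ, S.mem_vertexSet σ⟩).symm
  rw [this]
  exact MeasurableSet.iUnion fun I => (S.measurableSet_indices I).inter (hO I).measurableSet

/-- The image of a compact set under `lift` lies in the union of its images under the continuous
maps `liftOn I`, which are defined on closed sets. -/
theorem exists_isCompact_lift {K : Set (SingularSimplex k X)} (hK : IsCompact K) :
    ∃ L : Set (Whiskered X x₀ k), IsCompact L ∧ Set.MapsTo S.lift K L := by
  refine ⟨⋃ I, S.liftOn I '' (Subtype.val ⁻¹' K), isCompact_iUnion fun I => ?_, fun σ hσ => ?_⟩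
  · exact ((S.isClosed_vertexSet I).isClosedEmbedding_subtypeVal.isCompact_preimage hK).image
      (S.continuous_liftOn I)
  · exact Set.mem_iUnion.mpr ⟨S.indices σ, _, hσ, rfl⟩

end PathSystem

/-! ### Prism operators and cochains -/

/-- Measurable maps `P i : T_k → T_(k+1)` that satisfy the identities of the face maps of a prism,
so that they are a semisimplicial homotopy from the identity to `endo`. -/
structure PrismOperators (T : SemisimplicialSpace.{u}) where
  /-- The end of the homotopy. -/
  endo : ∀ {k : ℕ}, T.obj k → T.obj k
  /-- The prism operators. -/
  P : ∀ {k : ℕ}, Fin (k + 1) → T.obj k → T.obj (k + 1)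
  measurable_endo : ∀ k : ℕ, Measurable (endo : T.obj k → T.obj k)
  measurable_P : ∀ {k : ℕ} (i : Fin (k + 1)), Measurable (P i)
  face_zero : ∀ {k : ℕ} (σ : T.obj k), T.face 0 (P 0 σ) = endo σ
  face_last : ∀ {k : ℕ} (σ : T.obj k), T.face (Fin.last _) (P (Fin.last _) σ) = σ
  face_of_le : ∀ {k : ℕ} (i : Fin (k + 1)) (j : Fin (k + 2)) (_ : j ≤ i.castSucc)
    (σ : T.obj (k + 1)), T.face j.castSucc (P i.succ σ) = P i (T.face j σ)
  face_succ : ∀ {k : ℕ} (i : Fin (k + 1)) (σ : T.obj (k + 1)),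
    T.face i.succ.castSucc (P i.succ σ) = T.face i.succ.castSucc (P i.castSucc σ)
  face_of_lt : ∀ {k : ℕ} (i : Fin (k + 1)) (j : Fin (k + 2)) (_ : i.castSucc < j)
    (σ : T.obj (k + 1)), T.face j.succ (P i.castSucc σ) = P i (T.face j σ)

namespace PrismOperators

variable {T : SemisimplicialSpace.{u}} (Q : PrismOperators T)

/-- The map `(s f)(σ) = ∑ᵢ (-1)^i f(Pᵢ σ)` on functions. -/
def dualHomotopy (k : ℕ) : (T.obj (k + 1) → ℝ) →ₗ[ℝ] (T.obj k → ℝ) :=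
  ∑ i : Fin (k + 1), (-1 : ℝ) ^ (i : ℕ) • LinearMap.funLeft ℝ ℝ (Q.P i)

theorem dualHomotopy_apply {k : ℕ} (f : T.obj (k + 1) → ℝ) (σ : T.obj k) :
    Q.dualHomotopy k f σ = ∑ i : Fin (k + 1), (-1 : ℝ) ^ (i : ℕ) * f (Q.P i σ) := by
  simp [dualHomotopy, LinearMap.sum_apply, Finset.sum_apply, LinearMap.funLeft_apply]

theorem dualHomotopy_mem (κ : CochainKind) {k : ℕ} {f : T.obj (k + 1) → ℝ}
    (hf : f ∈ κ.functions (T.obj (k + 1))) : Q.dualHomotopy k f ∈ κ.functions (T.obj k) := by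
  rw [dualHomotopy, LinearMap.sum_apply]
  exact Submodule.sum_mem _ fun i _ => Submodule.smul_mem _ _ (κ.comp_mem hf (Q.measurable_P i))

theorem dualHomotopy_coboundary_zero (f : T.obj 0 → ℝ) (σ : T.obj 0) :
    Q.dualHomotopy 0 (coboundary T 0 f) σ = f (Q.endo σ) - f σ := by
  rw [dualHomotopy_apply]
  have h := Q.face_last σ
  change T.face 1 (Q.P 0 σ) = σ at h
  simp [coboundary, Fin.sum_univ_two, Q.face_zero, h, sub_eq_add_neg]

theorem coboundary_dualHomotopy_add {k : ℕ} (f : T.obj (k + 1) → ℝ) (σ : T.obj (k + 1)) :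
    coboundary T k (Q.dualHomotopy k f) σ + Q.dualHomotopy (k + 1) (coboundary T (k + 1) f) σ =
      f (Q.endo σ) - f σ := by
  have key := alternating_prism_sum (fun i j => f (T.face j (Q.P i σ)))
    (fun i j => f (Q.P i (T.face j σ)))
    (fun i j h => congrArg f (Q.face_of_le i j h σ)) (fun i => congrArg f (Q.face_succ i σ))
    (fun i j h => congrArg f (Q.face_of_lt i j h σ))
  simp only [Q.face_zero, Q.face_last] at key
  rw [← key, add_comm, Finset.sum_comm (s := (Finset.univ : Finset (Fin (k + 1)))),
    dualHomotopy_apply]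
  simp only [coboundary, LinearMap.coe_mk, AddHom.coe_mk, dualHomotopy_apply, Finset.mul_sum,
    smul_eq_mul]
  congr 1
  · exact Finset.sum_congr rfl fun i _ => Finset.sum_congr rfl fun j _ => by ring
  · exact Finset.sum_congr rfl fun i _ => Finset.sum_congr rfl fun j _ => by ring

theorem cochain_homotopy (κ : CochainKind) (A : cochainComplex κ T ⟶ cochainComplex κ T)
    (hA : ∀ k, A.f k = ModuleCat.ofHom ((LinearMap.funLeft ℝ ℝ Q.endo).restrict
      fun _ h => κ.comp_mem h (Q.measurable_endo k))) :
    Nonempty (Homotopy A (𝟙 (cochainComplex κ T))) := by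
  let s : ∀ i j : ℕ, (ComplexShape.up ℕ).Rel j i →
      ((cochainComplex κ T).X i ⟶ (cochainComplex κ T).X j) := fun i j h => by
    obtain rfl : j + 1 = i := h
    exact ModuleCat.ofHom ((Q.dualHomotopy j).restrict fun _ h => Q.dualHomotopy_mem κ h)
  have hs : A - 𝟙 _ = Homotopy.nullHomotopicMap' s := by
    ext k : 1
    cases k with
    | zero =>
      rw [Homotopy.nullHomotopicMap'_f_of_not_rel_right (k₀ := 1) (k₁ := 0) (by simp) (by simp),
        cochainComplex_d, HomologicalComplex.sub_f_apply, hA]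
      ext f : 2
      exact Subtype.ext (funext fun σ => (Q.dualHomotopy_coboundary_zero f.1 σ).symm)
    | succ k =>
      rw [Homotopy.nullHomotopicMap'_f (k₀ := k + 2) (k₁ := k + 1) (k₂ := k) (by simp) (by simp),
        cochainComplex_d, cochainComplex_d, HomologicalComplex.sub_f_apply, hA]
      ext f : 2
      refine Subtype.ext (funext fun σ => ?_)
      exact ((add_comm _ _).trans (Q.coboundary_dualHomotopy_add f.1 σ)).symm
  refine ⟨Homotopy.equivSubZero.symm ?_⟩
  rw [hs]
  exact Homotopy.nullHomotopy' s

end PrismOperators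

/-- The map of cochain complexes that is induced by measurable maps which commute with faces. -/
def pullback (κ : CochainKind) {T T' : SemisimplicialSpace.{u}} (φ : ∀ k, T.obj k → T'.obj k)
    (hφ : ∀ k, Measurable (φ k))
    (hface : ∀ {k : ℕ} (i : Fin (k + 2)) (σ : T.obj (k + 1)),
      T'.face i (φ (k + 1) σ) = φ k (T.face i σ)) :
    cochainComplex κ T' ⟶ cochainComplex κ T :=
  CochainComplex.ofHom
    (fun k => ModuleCat.ofHom
      ((LinearMap.funLeft ℝ ℝ (φ k)).restrict fun _ h => κ.comp_mem h (hφ k)))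
    (fun (k : ℕ) => by
      rw [cochainComplex_d, cochainComplex_d]
      ext f : 2
      refine Subtype.ext (funext fun σ => ?_)
      change ∑ i : Fin (k + 2), (-1 : ℝ) ^ (i : ℕ) * f.1 (φ k (T.face i σ)) =
        ∑ i : Fin (k + 2), (-1 : ℝ) ^ (i : ℕ) * f.1 (T'.face i (φ (k + 1) σ))
      simp only [hface])

/-! ### The prism operators of a path system -/

namespace Whiskered

variable {X : Type u} [TopologicalSpace X] {x₀ : X} {k : ℕ}

/-- The end of the homotopy `push`. -/
def pushEnd (w : Whiskered X x₀ k) : SingularSimplex k X :=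
  (push w).comp ⟨fun p => (p, 1), by fun_prop⟩

/-- The restriction of the homotopy `push` to a simplex of the prism decomposition. -/
def pushPrism (i : Fin (k + 1)) (w : Whiskered X x₀ k) : SingularSimplex (k + 1) X :=
  (push w).comp (prism i)

theorem continuous_pushEnd : Continuous (pushEnd : Whiskered X x₀ k → _) :=
  (ContinuousMap.continuous_precomp _).comp push.continuous

theorem continuous_pushPrism (i : Fin (k + 1)) :
    Continuous (pushPrism i : Whiskered X x₀ k → _) :=
  (ContinuousMap.continuous_precomp _).comp push.continuous

theorem pushEnd_mem (w : Whiskered X x₀ k) : w.pushEnd ∈ pointedSimplices X x₀ k :=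
  push_vertex_one w

theorem pushPrism_mem (i : Fin (k + 1)) (w : Whiskered X x₀ k)
    (h : ∀ j, w.1.1 (vertex k j) = x₀) : w.pushPrism i ∈ pointedSimplices X x₀ (k + 1) := by
  intro x
  change push w (prism i (vertex (k + 1) x)) = x₀
  rw [prism, toCylinder_vertex]
  split_ifs
  · rw [push_zero, h]
  · rw [push_vertex_one]

end Whiskered

/-- A map to `S_k^{x₀}(X)` is Borel if it is Borel as a map to `S_k(X)`. -/
theorem measurable_pointed {X : Type u} [TopologicalSpace X] {x₀ : X} {α : Type*}
    [MeasurableSpace α] {k : ℕ}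
    {f : α → (pointedSpace X x₀).obj k} (hf : Measurable fun a => pointedInclusion X x₀ k (f a)) :
    Measurable f := by
  refine measurable_of_isOpen fun V hV => ?_
  obtain ⟨O, hO, rfl⟩ := isOpen_induced_iff.mp hV
  exact hf hO.measurableSet

namespace PathSystem

variable {X : Type u} [TopologicalSpace X] {x₀ : X} {n : ℕ} (S : PathSystem X x₀ n)

/-- The simplex with the vertices pushed along the chosen paths to `x₀`. -/
def endMap {k : ℕ} (σ : SingularSimplex k X) : SingularSimplex k X := (S.lift σ).pushEnd

/-- The `i`-th simplex in the prism between a simplex and its image under `endMap`. -/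
def prismMap {k : ℕ} (i : Fin (k + 1)) (σ : SingularSimplex k X) : SingularSimplex (k + 1) X :=
  (S.lift σ).pushPrism i

theorem measurable_endMap {k : ℕ} : Measurable (S.endMap (k := k)) :=
  S.measurable_comp_lift Whiskered.continuous_pushEnd

theorem measurable_prismMap {k : ℕ} (i : Fin (k + 1)) : Measurable (S.prismMap i) :=
  S.measurable_comp_lift (Whiskered.continuous_pushPrism i)

theorem endMap_mem {k : ℕ} (σ : SingularSimplex k X) : S.endMap σ ∈ pointedSimplices X x₀ k :=
  Whiskered.pushEnd_mem _

theorem prismMap_mem {k : ℕ} (i : Fin (k + 1)) {σ : SingularSimplex k X}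
    (h : σ ∈ pointedSimplices X x₀ k) : S.prismMap i σ ∈ pointedSimplices X x₀ (k + 1) :=
  Whiskered.pushPrism_mem i (S.lift σ) h

theorem face_endMap {k : ℕ} (i : Fin (k + 2)) (σ : SingularSimplex (k + 1) X) :
    face i (S.endMap σ) = S.endMap (face i σ) := by
  refine ContinuousMap.ext fun p => ?_
  change push (S.lift σ) (faceInclusion k i p, 1) = push (S.lift (face i σ)) (p, 1)
  rw [lift_face, push_face]

theorem face_zero_prismMap {k : ℕ} (σ : SingularSimplex k X) :
    face 0 (S.prismMap 0 σ) = S.endMap σ :=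
  ContinuousMap.ext fun p => congrArg (push (S.lift σ)) (prism_zero_face p)

theorem face_last_prismMap {k : ℕ} (σ : SingularSimplex k X) :
    face (Fin.last _) (S.prismMap (Fin.last _) σ) = σ :=
  ContinuousMap.ext fun p =>
    (congrArg (push (S.lift σ)) (prism_last_face p)).trans (push_zero _ _)

theorem face_prismMap_of_le {k : ℕ} (i : Fin (k + 1)) (j : Fin (k + 2)) (h : j ≤ i.castSucc)
    (σ : SingularSimplex (k + 1) X) :
    face j.castSucc (S.prismMap i.succ σ) = S.prismMap i (face j σ) := by
  refine ContinuousMap.ext fun p => (congrArg (push (S.lift σ)) (prism_face_of_le i j h p)).trans ?_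
  rw [← push_face, ← lift_face]
  rfl

theorem face_prismMap_succ {k : ℕ} (i : Fin (k + 1)) (σ : SingularSimplex (k + 1) X) :
    face i.succ.castSucc (S.prismMap i.succ σ) = face i.succ.castSucc (S.prismMap i.castSucc σ) :=
  ContinuousMap.ext fun p => congrArg (push (S.lift σ)) (prism_face_succ i p)

theorem face_prismMap_of_lt {k : ℕ} (i : Fin (k + 1)) (j : Fin (k + 2)) (h : i.castSucc < j)
    (σ : SingularSimplex (k + 1) X) :
    face j.succ (S.prismMap i.castSucc σ) = S.prismMap i (face j σ) := by
  refine ContinuousMap.ext fun p => (congrArg (push (S.lift σ)) (prism_face_of_lt i j h p)).trans ?_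
  rw [← push_face, ← lift_face]
  rfl

/-- The prism operators on all singular simplices that push the vertices along the chosen paths. -/
def prismOperators : PrismOperators (singularSpace X) where
  endo := S.endMap
  P := S.prismMap
  measurable_endo _ := S.measurable_endMap
  measurable_P := S.measurable_prismMap
  face_zero := S.face_zero_prismMap
  face_last := S.face_last_prismMap
  face_of_le := S.face_prismMap_of_le
  face_succ := S.face_prismMap_succ
  face_of_lt := S.face_prismMap_of_lt

/-- The map `S_k(X) → S_k^{x₀}(X)` that pushes the vertices to `x₀`. -/
def toPointed (k : ℕ) (σ : (singularSpace X).obj k) : (pointedSpace X x₀).obj k :=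
  ⟨S.endMap σ, S.endMap_mem σ⟩

theorem measurable_toPointed (k : ℕ) : Measurable (S.toPointed k) :=
  measurable_pointed S.measurable_endMap

/-- The prism operators restrict to the simplices with all vertices in `x₀`. -/
def pointedPrismOperators : PrismOperators (pointedSpace X x₀) where
  endo {k} σ := S.toPointed k (pointedInclusion X x₀ k σ)
  P i σ := ⟨S.prismMap i σ.1, S.prismMap_mem i σ.2⟩
  measurable_endo _ := (S.measurable_toPointed _).comp (measurable_pointedInclusion X x₀ _)
  measurable_P i := measurable_pointed
    ((S.measurable_prismMap i).comp (measurable_pointedInclusion X x₀ _))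
  face_zero σ := Subtype.ext (S.face_zero_prismMap σ.1)
  face_last σ := Subtype.ext (S.face_last_prismMap σ.1)
  face_of_le i j h σ := Subtype.ext (S.face_prismMap_of_le i j h σ.1)
  face_succ i σ := Subtype.ext (S.face_prismMap_succ i σ.1)
  face_of_lt i j h σ := Subtype.ext (S.face_prismMap_of_lt i j h σ.1)

theorem isIso_homologyMap_restriction (S : PathSystem X x₀ n) (κ : CochainKind) (k : ℕ) :
    IsIso (HomologicalComplex.homologyMap (restriction κ X x₀) k) := by
  let E : cochainComplex κ (pointedSpace X x₀) ⟶ cochainComplex κ (singularSpace X) :=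
    pullback κ S.toPointed S.measurable_toPointed fun i σ => Subtype.ext (S.face_endMap i σ)
  obtain ⟨h₁⟩ := S.prismOperators.cochain_homotopy κ (restriction κ X x₀ ≫ E) fun k => rfl
  obtain ⟨h₂⟩ := S.pointedPrismOperators.cochain_homotopy κ (E ≫ restriction κ X x₀) fun k => rfl
  exact inferInstanceAs (IsIso
    (HomotopyEquiv.toHomologyIso ⟨restriction κ X x₀, E, h₁, h₂⟩ k).hom)

end PathSystem

/-! ### The homotopy on measure chains -/

theorem map_map_measure {α β γ : Type u} [MeasurableSpace α] [MeasurableSpace β]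
    [MeasurableSpace γ] (μ : SignedMeasure α) {f : α → β} {g : β → γ} (hf : Measurable f)
    (hg : Measurable g) : (μ.map f).map g = μ.map (fun a => g (f a)) := by
  ext A hA
  rw [VectorMeasure.map_apply _ hg hA, VectorMeasure.map_apply _ hf (hg hA),
    VectorMeasure.map_apply (f := fun a => g (f a)) _ (hg.comp hf) hA]
  rfl

/-- A homotopy between an endomorphism of a chain complex and the identity, from its components. -/
theorem nonempty_homotopy_id {K : ChainComplex (ModuleCat.{u} ℝ) ℕ} (A : K ⟶ K)
    (s : ∀ k, K.X k ⟶ K.X (k + 1)) (h0 : A.f 0 - 𝟙 _ = s 0 ≫ K.d 1 0)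
    (hs : ∀ k, A.f (k + 1) - 𝟙 _ = K.d (k + 1) k ≫ s k + s (k + 1) ≫ K.d (k + 2) (k + 1)) :
    Nonempty (Homotopy A (𝟙 K)) := by
  let s' : ∀ i j : ℕ, (ComplexShape.down ℕ).Rel j i → (K.X i ⟶ K.X j) := fun i j h => by
    obtain rfl : i + 1 = j := h
    exact s i
  have hA : A - 𝟙 _ = Homotopy.nullHomotopicMap' s' := by
    ext k : 1
    cases k with
    | zero =>
      rw [Homotopy.nullHomotopicMap'_f_of_not_rel_left (k₁ := 1) (k₀ := 0) (by simp) (by simp)]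
      exact h0
    | succ k =>
      rw [Homotopy.nullHomotopicMap'_f (k₂ := k + 2) (k₁ := k + 1) (k₀ := k) (by simp) (by simp)]
      exact hs k
  refine ⟨Homotopy.equivSubZero.symm ?_⟩
  rw [hA]
  exact Homotopy.nullHomotopy' s'

namespace PathSystem

variable {X : Type u} [TopologicalSpace X] {x₀ : X} {n : ℕ} (S : PathSystem X x₀ n)

/-- The map `s μ = ∑ᵢ (-1)^i (Pᵢ)_* μ` on signed measures. -/
def measureHomotopy (k : ℕ) :
    SignedMeasure (SingularSimplex k X) →ₗ[ℝ] SignedMeasure (SingularSimplex (k + 1) X) :=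
  ∑ i : Fin (k + 1), (-1 : ℝ) ^ (i : ℕ) • VectorMeasure.mapₗ (S.prismMap i)

theorem measureHomotopy_apply {k : ℕ} (μ : SignedMeasure (SingularSimplex k X)) :
    S.measureHomotopy k μ =
      ∑ i : Fin (k + 1), (-1 : ℝ) ^ (i : ℕ) • μ.map (S.prismMap i) := by
  simp [measureHomotopy, LinearMap.sum_apply, VectorMeasure.mapₗ]

/-- The map `e_*` on signed measures, where `e` pushes the vertices to `x₀`. -/
def measureEnd (k : ℕ) :
    SignedMeasure (SingularSimplex k X) →ₗ[ℝ] SignedMeasure (SingularSimplex k X) :=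
  VectorMeasure.mapₗ S.endMap

theorem measureEnd_apply {k : ℕ} (μ : SignedMeasure (SingularSimplex k X)) :
    S.measureEnd k μ = μ.map S.endMap := rfl

theorem boundary_measureHomotopy_zero (μ : SignedMeasure (SingularSimplex 0 X)) :
    boundary X 0 (S.measureHomotopy 0 μ) = S.measureEnd 0 μ - μ := by
  have h0 : (μ.map (S.prismMap 0)).map (face 0) = S.measureEnd 0 μ := by
    rw [map_map_measure μ (S.measurable_prismMap 0) (measurable_face 0)]
    exact congrArg μ.map (funext S.face_zero_prismMap)
  have h1 : (μ.map (S.prismMap 0)).map (face 1) = μ := by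
    rw [map_map_measure μ (S.measurable_prismMap 0) (measurable_face 1)]
    exact (congrArg μ.map (funext S.face_last_prismMap)).trans (VectorMeasure.map_id μ)
  have hs : S.measureHomotopy 0 μ = μ.map (S.prismMap 0) := by
    rw [measureHomotopy_apply]
    exact (Fin.sum_univ_one _).trans (one_smul ℝ _)
  rw [hs, boundary_apply]
  refine (Fin.sum_univ_two _).trans ?_
  rw [h0, h1, Fin.val_zero, Fin.val_one, pow_zero, pow_one, one_smul, sub_eq_add_neg]
  exact congrArg _ (neg_one_smul ℝ μ)

theorem boundary_measureHomotopy_add {k : ℕ} (μ : SignedMeasure (SingularSimplex (k + 1) X)) :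
    boundary X (k + 1) (S.measureHomotopy (k + 1) μ) + S.measureHomotopy k (boundary X k μ) =
      S.measureEnd (k + 1) μ - μ := by
  have key := alternating_prism_sum
    (fun i j => μ.map fun σ => face j (S.prismMap i σ))
    (fun i j => μ.map fun σ => S.prismMap i (face j σ))
    (fun i j h => congrArg μ.map (funext fun σ => S.face_prismMap_of_le i j h σ))
    (fun i => congrArg μ.map (funext fun σ => S.face_prismMap_succ i σ))
    (fun i j h => congrArg μ.map (funext fun σ => S.face_prismMap_of_lt i j h σ))
  have h0 : (μ.map fun σ => face 0 (S.prismMap 0 σ)) =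
      S.measureEnd (k + 1) μ := congrArg μ.map (funext S.face_zero_prismMap)
  have h1 : (μ.map fun σ => face (Fin.last _)
      (S.prismMap (Fin.last _) σ)) = μ :=
    (congrArg μ.map (funext S.face_last_prismMap)).trans (VectorMeasure.map_id μ)
  rw [h0, h1] at key
  rw [← key, measureHomotopy_apply, map_sum, boundary_apply μ, map_sum]
  congr 1
  · refine Finset.sum_congr rfl fun i _ => ?_
    rw [map_smul, boundary_apply, Finset.smul_sum]
    refine Finset.sum_congr rfl fun j _ => ?_
    rw [smul_smul, map_map_measure μ (S.measurable_prismMap i) (measurable_face j)]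
  · rw [Finset.sum_comm]
    refine Finset.sum_congr rfl fun j _ => ?_
    rw [map_smul, measureHomotopy_apply, Finset.smul_sum]
    refine Finset.sum_congr rfl fun i _ => ?_
    rw [smul_smul, map_map_measure μ (measurable_face j) (S.measurable_prismMap i), mul_comm]

theorem boundary_measureEnd {k : ℕ} (μ : SignedMeasure (SingularSimplex (k + 1) X)) :
    boundary X k (S.measureEnd (k + 1) μ) = S.measureEnd k (boundary X k μ) := by
  rw [boundary_apply, boundary_apply, map_sum]
  refine Finset.sum_congr rfl fun i _ => ?_
  rw [map_smul, measureEnd_apply, measureEnd_apply,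
    map_map_measure μ S.measurable_endMap (measurable_face i),
    map_map_measure μ (measurable_face i) S.measurable_endMap]
  exact congrArg (fun f => (-1 : ℝ) ^ (i : ℕ) • μ.map f) (funext (S.face_endMap i))

theorem exists_isCompact_measureEnd {k : ℕ} {μ : SignedMeasure (SingularSimplex k X)}
    (hμ : μ ∈ measureChains X k) :
    ∃ K, IsCompact K ∧ K ⊆ pointedSimplices X x₀ k ∧ IsDeterminationSet (S.measureEnd k μ) K := by
  obtain ⟨K, hK, hμ⟩ := hμ
  obtain ⟨L, hL, hKL⟩ := S.exists_isCompact_lift hK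
  refine ⟨Whiskered.pushEnd '' L, hL.image Whiskered.continuous_pushEnd, ?_,
    hμ.map S.measurable_endMap fun σ hσ => ⟨_, hKL hσ, rfl⟩⟩
  rintro _ ⟨w, -, rfl⟩
  exact w.pushEnd_mem

theorem measureEnd_mem {k : ℕ} {μ : SignedMeasure (SingularSimplex k X)}
    (hμ : μ ∈ measureChains X k) : S.measureEnd k μ ∈ pointedMeasureChains X x₀ k := by
  obtain ⟨K, hK, hKp, hKμ⟩ := S.exists_isCompact_measureEnd hμ
  exact ⟨⟨K, hK, hKμ⟩, fun A hA hAp => hKμ A hA (hAp.trans (Set.compl_subset_compl.mpr hKp))⟩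

theorem measureHomotopy_mem {k : ℕ} {μ : SignedMeasure (SingularSimplex k X)}
    (hμ : μ ∈ measureChains X k) : S.measureHomotopy k μ ∈ measureChains X (k + 1) := by
  obtain ⟨K, hK, hμ⟩ := hμ
  obtain ⟨L, hL, hKL⟩ := S.exists_isCompact_lift hK
  rw [measureHomotopy_apply]
  exact Submodule.sum_mem _ fun i _ => Submodule.smul_mem _ _
    ⟨Whiskered.pushPrism i '' L, hL.image (Whiskered.continuous_pushPrism i),
      hμ.map (S.measurable_prismMap i) fun σ hσ => ⟨_, hKL hσ, rfl⟩⟩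

theorem measureHomotopy_mem_pointed {k : ℕ} {μ : SignedMeasure (SingularSimplex k X)}
    (hμ : μ ∈ pointedMeasureChains X x₀ k) :
    S.measureHomotopy k μ ∈ pointedMeasureChains X x₀ (k + 1) := by
  refine ⟨S.measureHomotopy_mem hμ.1, ?_⟩
  have h : IsDeterminationSet μ (pointedSimplices X x₀ k) := hμ.2
  rw [measureHomotopy_apply]
  exact Submodule.sum_mem _ fun i _ => Submodule.smul_mem _ _
    (h.map (S.measurable_prismMap i) fun _ hσ => S.prismMap_mem i hσ)

/-- The end of the homotopy maps a cycle to a homologous one. -/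
theorem exists_homologous_pointed_cycle (S : PathSystem X x₀ n) (k : ℕ)
    {z : SignedMeasure (SingularSimplex k X)} (hz : z ∈ measureCycles X k) :
    ∃ z' ∈ measureCycles X k, z' - z ∈ measureBoundaries X k ∧
      ∃ K : Set (SingularSimplex k X), IsCompact K ∧ K ⊆ pointedSimplices X x₀ k ∧
        IsDeterminationSet z' K := by
  cases k with
  | zero =>
    exact ⟨S.measureEnd 0 z, (S.measureEnd_mem hz).1,
      ⟨S.measureHomotopy 0 z, S.measureHomotopy_mem hz, S.boundary_measureHomotopy_zero z⟩,
      S.exists_isCompact_measureEnd hz⟩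
  | succ k =>
    have hz0 : boundary X k z = 0 := hz.2
    refine ⟨S.measureEnd (k + 1) z, ⟨(S.measureEnd_mem hz.1).1, ?_⟩,
      ⟨S.measureHomotopy (k + 1) z, S.measureHomotopy_mem hz.1, ?_⟩,
      S.exists_isCompact_measureEnd hz.1⟩
    · change boundary X k (S.measureEnd (k + 1) z) = 0
      rw [boundary_measureEnd, hz0, map_zero]
    · rw [← boundary_measureHomotopy_add, hz0, map_zero, add_zero]

/-- The chain map `e_* : 𝒞_*(X) → 𝒞_*^{x₀}(X)`, a homotopy inverse of the inclusion. -/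
def toPointedMeasures : measureComplex X ⟶ pointedMeasureComplex X x₀ :=
  ChainComplex.ofHom
    (fun k => ModuleCat.ofHom ((S.measureEnd k).restrict fun _ h => S.measureEnd_mem h))
    (fun k => by
      rw [measureComplex_d, pointedMeasureComplex_d]
      ext μ : 2
      exact Subtype.ext (S.boundary_measureEnd μ.1))

theorem nonempty_homotopy_toPointedMeasures :
    Nonempty (Homotopy (S.toPointedMeasures ≫ measureInclusion X x₀) (𝟙 (measureComplex X))) := by
  refine nonempty_homotopy_id _ (fun k => ModuleCat.ofHom
    ((S.measureHomotopy k).restrict fun _ h => S.measureHomotopy_mem h)) ?_ fun k => ?_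
  · rw [measureComplex_d]
    ext μ : 2
    exact Subtype.ext (S.boundary_measureHomotopy_zero μ.1).symm
  · rw [measureComplex_d, measureComplex_d]
    ext μ : 2
    exact Subtype.ext ((add_comm _ _).trans (S.boundary_measureHomotopy_add μ.1)).symm

theorem nonempty_homotopy_measureInclusion :
    Nonempty (Homotopy (measureInclusion X x₀ ≫ S.toPointedMeasures)
      (𝟙 (pointedMeasureComplex X x₀))) := by
  refine nonempty_homotopy_id _ (fun k => ModuleCat.ofHom
    ((S.measureHomotopy k).restrict fun _ h => S.measureHomotopy_mem_pointed h)) ?_ fun k => ?_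
  · rw [pointedMeasureComplex_d]
    ext μ : 2
    exact Subtype.ext (S.boundary_measureHomotopy_zero μ.1).symm
  · rw [pointedMeasureComplex_d, pointedMeasureComplex_d]
    ext μ : 2
    exact Subtype.ext ((add_comm _ _).trans (S.boundary_measureHomotopy_add μ.1)).symm

theorem exists_retraction (S : PathSystem X x₀ n) :
    ∃ η : measureComplex X ⟶ pointedMeasureComplex X x₀,
      measureInclusion X x₀ ≫ η = 𝟙 (pointedMeasureComplex X x₀) ∧
      Nonempty (Homotopy (η ≫ measureInclusion X x₀) (𝟙 (measureComplex X))) := by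
  obtain ⟨s⟩ := S.nonempty_homotopy_toPointedMeasures
  obtain ⟨s'⟩ := S.nonempty_homotopy_measureInclusion
  have hinj : ∀ k, Function.Injective ((measureInclusion X x₀).f k).hom := fun k =>
    Submodule.inclusion_injective
      (inf_le_left : pointedMeasureChains X x₀ k ≤ measureChains X k)
  -- Over a field each component of the inclusion has a linear left inverse.
  choose r hr using fun k => LinearMap.exists_leftInverse_of_injective
    ((measureInclusion X x₀).f k).hom (LinearMap.ker_eq_bot.mpr (hinj k))
  exact exists_retraction_of_homotopy (measureInclusion X x₀) (fun k => ModuleCat.ofHom (r k))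
    (fun k => ModuleCat.hom_ext (hr k)) S.toPointedMeasures s s'

end PathSystem

end MeasureHomology

end

theorem lemma5p2 {X : Type*} [TopologicalSpace X] [PathConnectedSpace X]
    {n : ℕ} (U : Fin n → Set X) (hcover : ⋃ i, U i = Set.univ)
    (hborel : ∀ i, @MeasurableSet X (borel X) (U i))
    (hcompact : ∀ i, IsCompact (closure (U i)))
    (hcontr : ∀ i, MeasureHomology.ContractibleIn (closure (U i)))
    (x₀ : X) :
    -- the inclusion of pointed measure chains has a retraction that is a homotopy inverse
    (∃ η : MeasureHomology.measureComplex X ⟶ MeasureHomology.pointedMeasureComplex X x₀,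
      MeasureHomology.measureInclusion X x₀ ≫ η = 𝟙 (MeasureHomology.pointedMeasureComplex X x₀) ∧
      Nonempty (Homotopy (η ≫ MeasureHomology.measureInclusion X x₀)
        (𝟙 (MeasureHomology.measureComplex X)))) ∧
    -- every cycle is homologous to a cycle with compact determination set in the pointed simplices
    (∀ (k : ℕ), ∀ z ∈ MeasureHomology.measureCycles X k,
      ∃ z' ∈ MeasureHomology.measureCycles X k,
        z' - z ∈ MeasureHomology.measureBoundaries X k ∧
        ∃ K : Set (MeasureHomology.SingularSimplex k X), IsCompact K ∧
          K ⊆ MeasureHomology.pointedSimplices X x₀ k ∧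
          MeasureHomology.IsDeterminationSet z' K) ∧
    -- restriction is an isomorphism in bounded, measurable bounded and measurable cohomology
    (∀ k : ℕ, IsIso (HomologicalComplex.homologyMap
      (MeasureHomology.restriction .bounded X x₀) k)) ∧
    (∀ k : ℕ, IsIso (HomologicalComplex.homologyMap
      (MeasureHomology.restriction .measurableBounded X x₀) k)) ∧
    (∀ k : ℕ, IsIso (HomologicalComplex.homologyMap
      (MeasureHomology.restriction .measurable X x₀) k)) := by
  obtain ⟨S⟩ := MeasureHomology.nonempty_pathSystem U hcover hborel hcontr x₀
  exact ⟨S.exists_retraction, fun k z hz => S.exists_homologous_pointed_cycle k hz,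
    S.isIso_homologyMap_restriction .bounded, S.isIso_homologyMap_restriction .measurableBounded,
    S.isIso_homologyMap_restriction .measurable⟩
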